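/- **Notation.** For a probability measure $\eta$ on $\mathbb R$ let $F_\eta^{-1}(u)=\inf\{x:\eta((-\infty,x])\ge u\}$, $u\in(0,1)$; write $\eta\le_{st}\eta'$ if $F_\eta^{-1}\le F_{\eta'}^{-1}$ on $(0,1)$. $\mathcal P_1(\mathbb R)$ is the set of probability measures on $\mathbb R$ with finite first moment, $\mu\le_{cx}\nu$ is the convex order, $\Pi(\cdot,\cdot)$ denotes sets of couplings, $\lambda_{(0,1)}$ is Lebesgue measure on $(0,1)$, and $\mathcal W_1$ is the Wasserstein distance of order one. For $\pi,\pi'$ with first marginals $\mu,\mu'$ and disintegrations $\pi=\mu\times\pi_x$, $\pi'=\mu'\times\pi'_x$, $$\mathcal{AW}_1(\pi,\pi')=\inf_{\chi\in\Pi(\mu,\mu')}\int(|x-x'|+\mathcal W_1(\pi_x,\pi'_{x'}))\,\chi(dx,dx').$$ A *lifted coupling* between $\mu$ and $\nu$ is a measure $\widehat\pi=\lambda_{(0,1)}(du)\,\delta_{F_\mu^{-1}(u)}(dx)\,p_u(dy)$ on $(0,1)\times\mathbb R\times\mathbb R$, with $(p_u)$ a probability kernel, whose marginal in $(x,y)$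 lies in $\Pi(\mu,\nu)$ (it is then called a lifted coupling of that marginal). It is a *lifted martingale coupling*, $\widehat\pi\in\widehat\Pi^{\mathrm M}(\mu,\nu)$, if $\int y\,p_u(dy)=F_\mu^{-1}(u)$ for almost every $u$. With $\widehat\pi_u=\delta_{F_\mu^{-1}(u)}\times p_u$ the disintegration in $u$, $$\widehat{\mathcal{AW}}_1(\widehat\pi,\widehat\pi')=\inf_{\chi\in\Pi(\lambda_{(0,1)},\lambda_{(0,1)})}\int(|u-u'|+\mathcal{AW}_1(\widehat\pi_u,\widehat\pi'_{u'}))\,\chi(du,du').$$ A lifted martingale rearrangement coupling of $\widehat\pi$ is an $\widehat M\in\widehat\Pi^{\mathrm M}(\mu,\nu)$ with $\widehat{\mathcal{AW}}_1(\widehat\pi,\widehat M)=\inf_{\widehat M'\in\widehat\Pi^{\mathrm M}(\mu,\nu)}\widehat{\mathcal{AW}}_1(\widehat\pi,\widehat M')$. **Exchange maps.** Let $\mathfrak B$ be the set of $(y,\tilde y,\eta,\tilde\eta)\in\mathbb R^2\times\mathcal P_1(\mathbb R)^2$ such that the means $x,\tilde x$ of $\eta,\tilde\eta$ satisfy $x<y\le\tilde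 y<\tilde x$, and put $p=\frac{\tilde x-\tilde y}{y-x+\tilde x-\tilde y}$. A pair of exchange maps is a pair of measurable maps $\beta,\tilde\beta:\mathfrak B\to\mathcal P_1(\mathbb R)$ (for the Borel $\sigma$-algebra of weak convergence) such that on all of $\mathfrak B$ the measures $\beta,\tilde\beta$ have means $y,\tilde y$, $\eta\le_{st}\beta$, $\tilde\beta\le_{st}\tilde\eta$ and $p\beta+(1-p)\tilde\beta=p\eta+(1-p)\tilde\eta$. The explicit pair is as follows. Let $$J(q)=\int_0^{q/p}F_{\tilde\eta}^{-1}\Big(\tfrac{1-pu-p}{1-p}\Big)du+\int_{q/p}^1F_\eta^{-1}(u)\,du,\qquad \tilde J(q)=\int_0^{q/(1-p)}F_\eta^{-1}\Big(\tfrac{(1-p)u}{p}\Big)du+\int_0^{\frac{1-q-p}{1-p}}F_{\tilde\eta}^{-1}(u)\,du,$$ let $q_\star$ be the solution in $[0,p]$ of $J(q)=y$ if $p\le\frac12$ and the solution in $[0,1-p]$ of $\tilde J(q)=\tilde y$ if $p>\frac12$, and let $\beta,\tilde\beta$ be the images of $\lambda_{(0,1)}$ under $$u\mapsto \mathbf 1_{\{u<q_\star/p\}}F_{\tilde\eta}^{-1}\Big(\tfrac{1-pu-p}{1-p}\Big)+\mathbf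 1_{\{u\ge q_\star/p\}}F_\eta^{-1}(u),\qquad u\mapsto \mathbf 1_{\{u<\frac{q_\star}{1-p}\}}F_\eta^{-1}\Big(\tfrac{(1-p)u}{p}\Big)+\mathbf 1_{\{u\ge\frac{q_\star}{1-p}\}}F_{\tilde\eta}^{-1}\Big(u-\tfrac{q_\star}{1-p}\Big).$$ **The kernel $m$.** Let $\mu,\nu\in\mathcal P_1(\mathbb R)$ with $\mu\le_{cx}\nu$, $\mu\ne\nu$, and let $\pi=\mu\times\pi_x\in\Pi(\mu,\nu)$ satisfy the barycentre dispersion assumption $$\forall a\in\mathbb R,\quad \int_{[a,\infty)}\Big(x-\int y\,\pi_x(dy)\Big)\mu(dx)\le0 .$$ Put $G(u)=\int y\,\pi_{F_\mu^{-1}(u)}(dy)$, which exists for almost every $u$, $\Delta_\pm(u)=\int_0^u(F_\mu^{-1}-G)^\pm(v)\,dv$, $\Delta_\pm^{-1}(v)=\inf\{r\in[0,1]:\Delta_\pm(r)\ge v\}$, and let $\mathcal U^+$ (resp. $\mathcal U^-$) be the set of $u\in(0,1)$ for which $G(u)$ exists and $F_\mu^{-1}(u)>G(u)$ (resp. $<$).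 Let $\phi=\Delta_-^{-1}\circ\Delta_+$ on $\mathcal U^+$, $\phi=\Delta_+^{-1}\circ\Delta_-$ on $\mathcal U^-$, $\phi(u)=u$ otherwise, and $$p(u)=\frac{G(\phi(u))-F_\mu^{-1}(\phi(u))}{F_\mu^{-1}(u)-G(u)+G(\phi(u))-F_\mu^{-1}(\phi(u))}.$$ Let $A^\pm=\{u\in\mathcal U^\pm:\phi(u)\in\mathcal U^\mp,\ \phi(\phi(u))=u,\ p(\phi(u))=1-p(u)\}$ and $b(u)=(F_\mu^{-1}(u),F_\mu^{-1}(\phi(u)),\pi_{F_\mu^{-1}(u)},\pi_{F_\mu^{-1}(\phi(u))})$. Given exchange maps $\beta,\tilde\beta$, set $m_u=\beta(b(u))$ for $u\in A^+$, $m_u=\tilde\beta(b(\phi(u)))$ for $u\in A^-$, and $m_u=\pi_{F_\mu^{-1}(u)}$ for all other $u$. Put $$\widehat M=\lambda_{(0,1)}(du)\,\delta_{F_\mu^{-1}(u)}(dx)\,m_u(dy),\qquad \iota(\pi)=\lambda_{(0,1)}(du)\,\delta_{F_\mu^{-1}(u)}(dx)\,\pi_{F_\mu^{-1}(u)}(dy).$$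 **Proposition.** The explicit pair is a pair of exchange maps. Moreover, under the above hypotheses on $\mu,\nu,\pi$, and for every choice of the disintegration $(\pi_x)$ and of the pair of exchange maps: $(m_u)$ is a probability kernel, $\iota(\pi)$ is a lifted coupling of $\pi$, and $\widehat M$ is a lifted martingale coupling between $\mu$ and $\nu$ and a lifted martingale rearrangement coupling of $\iota(\pi)$, with $$\inf_{\widehat M'\in\widehat\Pi^{\mathrm M}(\mu,\nu)}\widehat{\mathcal{AW}}_1(\iota(\pi),\widehat M')=\widehat{\mathcal{AW}}_1(\iota(\pi),\widehat M)=\int_0^1\mathcal W_1(\pi_{F_\mu^{-1}(u)},m_u)\,du=\int_0^1|G(u)-F_\mu^{-1}(u)|\,du<\infty .$$ -/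

import Mathlib

open MeasureTheory ProbabilityTheory Set

noncomputable section

namespace MartRearr

/-! ### Quantile functions, orders, couplings -/

/-- `η` is a probability measure on `ℝ` with finite first moment. -/
def IsP1 (η : Measure ℝ) : Prop :=
  IsProbabilityMeasure η ∧ Integrable (fun x : ℝ => x) η

/-- Quantile function `F_η⁻¹(u) = inf {x : η((-∞, x]) ≥ u}`, only meaningful for `u ∈ (0,1)`. -/
def quantile (η : Measure ℝ) (u : ℝ) : ℝ :=
  sInf {x : ℝ | u ≤ η.real (Iic x)}

/-- Stochastic order `η ≤_st η'`. -/
def StochLE (η η' : Measure ℝ) : Prop :=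
  ∀ u ∈ Ioo (0 : ℝ) 1, quantile η u ≤ quantile η' u

/-- Convex order `μ ≤_cx ν`. A convex function is bounded below by an affine one, so its integrals
against measures with finite first moment make sense in `(-∞, ∞]`; by truncation to convex functions
of linear growth it is equivalent to test only convex functions with two finite integrals. -/
def ConvexOrder (μ ν : Measure ℝ) : Prop :=
  ∀ f : ℝ → ℝ, ConvexOn ℝ univ f → Integrable f μ → Integrable f ν → ∫ x, f x ∂μ ≤ ∫ y, f y ∂ν

/-- `χ` has marginals `α` and `β`. -/
def IsCoupling {X Y : Type*} [MeasurableSpace X] [MeasurableSpace Y]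
    (α : Measure X) (β : Measure Y) (χ : Measure (X × Y)) : Prop :=
  χ.map Prod.fst = α ∧ χ.map Prod.snd = β

/-- Disintegration `(ρ_x)` of a finite measure `ρ` with respect to its first marginal,
`ρ(dx, dω) = ρ₁(dx) ρ_x(dω)`. (The value `0` for infinite measures is never used.) -/
def disint {X Ω : Type*} [MeasurableSpace X] [MeasurableSpace Ω] [StandardBorelSpace Ω]
    [Nonempty Ω] (ρ : Measure (X × Ω)) (x : X) : Measure Ω :=
  open scoped Classical in
  if h : IsFiniteMeasure ρ then (haveI := h; ρ.condKernel x) else 0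

/-! ### Wasserstein and adapted Wasserstein distances of order one -/

/-- Wasserstein distance `W₁` on measures on the line. -/
def W1 (η η' : Measure ℝ) : ENNReal :=
  ⨅ (χ : Measure (ℝ × ℝ)) (_ : IsCoupling η η' χ), ∫⁻ z, ENNReal.ofReal |z.1 - z.2| ∂χ

/-- Adapted Wasserstein distance `AW₁` on measures on `ℝ × ℝ`. -/
def AW1 (π π' : Measure (ℝ × ℝ)) : ENNReal :=
  ⨅ (χ : Measure (ℝ × ℝ)) (_ : IsCoupling (π.map Prod.fst) (π'.map Prod.fst) χ),
    ∫⁻ z, (ENNReal.ofReal |z.1 - z.2| + W1 (disint π z.1) (disint π' z.2)) ∂χ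

/-- Lifted adapted Wasserstein distance of order one on measures on `ℝ × ℝ × ℝ ∋ (u, x, y)`. -/
def liftedAW1 (P P' : Measure (ℝ × ℝ × ℝ)) : ENNReal :=
  ⨅ (χ : Measure (ℝ × ℝ)) (_ : IsCoupling (P.map Prod.fst) (P'.map Prod.fst) χ),
    ∫⁻ z, (ENNReal.ofReal |z.1 - z.2| + AW1 (disint P z.1) (disint P' z.2)) ∂χ

/-! ### Lifted couplings -/

/-- Lebesgue measure on `(0,1)`, as a measure on `ℝ`. -/
def lam : Measure ℝ := volume.restrict (Ioo (0 : ℝ) 1)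

/-- The measure `λ_(0,1)(du) δ_{F_μ⁻¹(u)}(dx) p_u(dy)` for a measurable family `p`. -/
def lift (μ : Measure ℝ) (p : ℝ → Measure ℝ) : Measure (ℝ × ℝ × ℝ) :=
  lam.bind fun u => (Measure.dirac u).prod ((Measure.dirac (quantile μ u)).prod (p u))

/-- `P` is a lifted coupling of `π`, where `π` is a coupling whose first marginal is `μ`. -/
def IsLiftOf (μ : Measure ℝ) (π : Measure (ℝ × ℝ)) (P : Measure (ℝ × ℝ × ℝ)) : Prop :=
  (∃ p : Kernel ℝ ℝ, IsMarkovKernel p ∧ P = lift μ p) ∧ P.map Prod.snd = π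

/-- `P ∈ Π̂(μ, ν)`: `P` is a lifted coupling of some coupling between `μ` and `ν`. -/
def IsLiftedCoupling (μ ν : Measure ℝ) (P : Measure (ℝ × ℝ × ℝ)) : Prop :=
  ∃ π : Measure (ℝ × ℝ), IsCoupling μ ν π ∧ IsLiftOf μ π P

/-- `P ∈ Π̂ᴹ(μ, ν)`: lifted martingale couplings. -/
def IsLiftedMartingaleCoupling (μ ν : Measure ℝ) (P : Measure (ℝ × ℝ × ℝ)) : Prop :=
  IsLiftedCoupling μ ν P ∧
    ∃ p : Kernel ℝ ℝ, IsMarkovKernel p ∧ P = lift μ p ∧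
      ∀ᵐ u ∂lam, Integrable (fun y : ℝ => y) (p u) ∧ ∫ y, y ∂(p u) = quantile μ u

/-- `inf` of the lifted adapted Wasserstein distance from `P` to `Π̂ᴹ(μ, ν)`. -/
def infLiftedAW1 (μ ν : Measure ℝ) (P : Measure (ℝ × ℝ × ℝ)) : ENNReal :=
  ⨅ (M' : Measure (ℝ × ℝ × ℝ)) (_ : IsLiftedMartingaleCoupling μ ν M'), liftedAW1 P M'

/-- `M` is a lifted martingale rearrangement coupling of `P`. -/
def IsLiftedMartingaleRearrangement (μ ν : Measure ℝ) (P M : Measure (ℝ × ℝ × ℝ)) : Prop :=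
  IsLiftedMartingaleCoupling μ ν M ∧ liftedAW1 P M = infLiftedAW1 μ ν P

/-- The embedding `ι`, for `π(dx, dy) = μ(dx) κ_x(dy)`. -/
def iota (μ : Measure ℝ) (κ : Kernel ℝ ℝ) : Measure (ℝ × ℝ × ℝ) :=
  lift μ fun u => κ (quantile μ u)

/-- Barycentre dispersion assumption for `π(dx, dy) = μ(dx) κ_x(dy)`. -/
def BarycentreDispersion (μ : Measure ℝ) (κ : Kernel ℝ ℝ) : Prop :=
  ∀ a : ℝ, ∫ x in Ici a, (x - ∫ y, y ∂(κ x)) ∂μ ≤ 0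

/-! ### Exchanging mass between two measures

A quadruple `(y, y', η, η')` consists of two reals and two laws. -/

/-- Quadruples with `η, η'` of means `x, x'` such that `x < y ≤ y' < x'`. -/
def quadruples : Set (ℝ × ℝ × Measure ℝ × Measure ℝ) :=
  {b | IsP1 b.2.2.1 ∧ IsP1 b.2.2.2 ∧
    ∫ w, w ∂b.2.2.1 < b.1 ∧ b.1 ≤ b.2.1 ∧ b.2.1 < ∫ w, w ∂b.2.2.2}

/-- The weight `(x' - y') / (y - x + x' - y')`. -/
def weight (b : ℝ × ℝ × Measure ℝ × Measure ℝ) : ℝ :=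
  (∫ w, w ∂b.2.2.2 - b.2.1) / (b.1 - ∫ w, w ∂b.2.2.1 + ∫ w, w ∂b.2.2.2 - b.2.1)

/-- `β, β'` exchange mass: for `b = (y, y', η, η')` the laws `β b, β' b` have means `y, y'`,
`η ≤_st β b`, `β' b ≤_st η'` and `p β b + (1 - p) β' b = p η + (1 - p) η'`; and both maps are
measurable on the quadruples. The `σ`-algebra on measures is generated by the evaluations; on
probability measures it is the Borel `σ`-algebra of weak convergence. -/
structure IsExchange (β β' : ℝ × ℝ × Measure ℝ × Measure ℝ → Measure ℝ) : Prop where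
  measurable_fst : Measurable fun b : quadruples => β b
  measurable_snd : Measurable fun b : quadruples => β' b
  isP1_fst : ∀ b ∈ quadruples, IsP1 (β b)
  isP1_snd : ∀ b ∈ quadruples, IsP1 (β' b)
  mean_fst : ∀ b ∈ quadruples, ∫ w, w ∂(β b) = b.1
  mean_snd : ∀ b ∈ quadruples, ∫ w, w ∂(β' b) = b.2.1
  stochLE_fst : ∀ b ∈ quadruples, StochLE b.2.2.1 (β b)
  stochLE_snd : ∀ b ∈ quadruples, StochLE (β' b) b.2.2.2
  mixture : ∀ b ∈ quadruples,
    ENNReal.ofReal (weight b) • β b + ENNReal.ofReal (1 - weight b) • β' b =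
      ENNReal.ofReal (weight b) • b.2.2.1 + ENNReal.ofReal (1 - weight b) • b.2.2.2

/-- The function `J`. -/
def fnJ (b : ℝ × ℝ × Measure ℝ × Measure ℝ) (q : ℝ) : ℝ :=
  (∫ u in (0 : ℝ)..(q / weight b),
      quantile b.2.2.2 ((1 - weight b * u - weight b) / (1 - weight b))) +
    ∫ u in (q / weight b)..1, quantile b.2.2.1 u

/-- The function `J̃`. -/
def fnJ' (b : ℝ × ℝ × Measure ℝ × Measure ℝ) (q : ℝ) : ℝ :=
  (∫ u in (0 : ℝ)..(q / (1 - weight b)), quantile b.2.2.1 ((1 - weight b) * u / weight b)) +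
    ∫ u in (0 : ℝ)..((1 - q - weight b) / (1 - weight b)), quantile b.2.2.2 u

/-- The amount `q⋆` of mass to exchange: the unique solution of `J(q) = y` in `[0, p]` if
`p ≤ 1/2`, and of `J̃(q) = y'` in `[0, 1 - p]` otherwise. -/
def qStar (b : ℝ × ℝ × Measure ℝ × Measure ℝ) : ℝ :=
  if weight b ≤ 1 / 2 then sInf {q | q ∈ Icc 0 (weight b) ∧ fnJ b q = b.1}
  else sInf {q | q ∈ Icc 0 (1 - weight b) ∧ fnJ' b q = b.2.1}

/-- The explicit first exchanged law. -/
def exchangeFst (b : ℝ × ℝ × Measure ℝ × Measure ℝ) : Measure ℝ :=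
  lam.map fun u =>
    if u < qStar b / weight b then
      quantile b.2.2.2 ((1 - weight b * u - weight b) / (1 - weight b))
    else quantile b.2.2.1 u

/-- The explicit second exchanged law. -/
def exchangeSnd (b : ℝ × ℝ × Measure ℝ × Measure ℝ) : Measure ℝ :=
  lam.map fun u =>
    if u < qStar b / (1 - weight b) then quantile b.2.2.1 ((1 - weight b) * u / weight b)
    else quantile b.2.2.2 (u - qStar b / (1 - weight b))

/-! ### The martingale kernel `m` built from `π(dx, dy) = μ(dx) κ_x(dy)` -/

/-- `G(u) = ∫ y κ_{F_μ⁻¹(u)}(dy)`. -/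
def G (μ : Measure ℝ) (κ : Kernel ℝ ℝ) (u : ℝ) : ℝ := ∫ y, y ∂(κ (quantile μ u))

/-- `Δ₊(u) = ∫₀ᵘ (F_μ⁻¹ - G)⁺`. -/
def DeltaPos (μ : Measure ℝ) (κ : Kernel ℝ ℝ) (u : ℝ) : ℝ :=
  ∫ v in (0 : ℝ)..u, max (quantile μ v - G μ κ v) 0

/-- `Δ₋(u) = ∫₀ᵘ (F_μ⁻¹ - G)⁻`. -/
def DeltaNeg (μ : Measure ℝ) (κ : Kernel ℝ ℝ) (u : ℝ) : ℝ :=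
  ∫ v in (0 : ℝ)..u, max (-(quantile μ v - G μ κ v)) 0

/-- Left-continuous generalized inverse of a nondecreasing function on `[0,1]`. -/
def genInv (D : ℝ → ℝ) (v : ℝ) : ℝ := sInf {r | r ∈ Icc (0 : ℝ) 1 ∧ v ≤ D r}

/-- `𝒰⁺ = {u ∈ (0,1) : F_μ⁻¹(u) > G(u)}`; the levels `u` (Lebesgue-null many under finite first
moments) at which the mean `G(u)` does not exist are left out. -/
def UPos (μ : Measure ℝ) (κ : Kernel ℝ ℝ) : Set ℝ :=
  {u | u ∈ Ioo (0 : ℝ) 1 ∧ Integrable (fun y : ℝ => y) (κ (quantile μ u)) ∧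
    G μ κ u < quantile μ u}

/-- `𝒰⁻ = {u ∈ (0,1) : F_μ⁻¹(u) < G(u)}`, with the same proviso. -/
def UNeg (μ : Measure ℝ) (κ : Kernel ℝ ℝ) : Set ℝ :=
  {u | u ∈ Ioo (0 : ℝ) 1 ∧ Integrable (fun y : ℝ => y) (κ (quantile μ u)) ∧
    quantile μ u < G μ κ u}

/-- The map `φ`. -/
def phi (μ : Measure ℝ) (κ : Kernel ℝ ℝ) (u : ℝ) : ℝ :=
  open scoped Classical in
  if u ∈ UPos μ κ then genInv (DeltaNeg μ κ) (DeltaPos μ κ u)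
  else if u ∈ UNeg μ κ then genInv (DeltaPos μ κ) (DeltaNeg μ κ u)
  else u

/-- The weight `p(u)`. -/
def pw (μ : Measure ℝ) (κ : Kernel ℝ ℝ) (u : ℝ) : ℝ :=
  (G μ κ (phi μ κ u) - quantile μ (phi μ κ u)) /
    (quantile μ u - G μ κ u + G μ κ (phi μ κ u) - quantile μ (phi μ κ u))

/-- The set `A⁺`. -/
def APos (μ : Measure ℝ) (κ : Kernel ℝ ℝ) : Set ℝ :=
  {u | u ∈ UPos μ κ ∧ phi μ κ u ∈ UNeg μ κ ∧ phi μ κ (phi μ κ u) = u ∧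
    pw μ κ (phi μ κ u) = 1 - pw μ κ u}

/-- The set `A⁻`. -/
def ANeg (μ : Measure ℝ) (κ : Kernel ℝ ℝ) : Set ℝ :=
  {u | u ∈ UNeg μ κ ∧ phi μ κ u ∈ UPos μ κ ∧ phi μ κ (phi μ κ u) = u ∧
    pw μ κ (phi μ κ u) = 1 - pw μ κ u}

/-- The quadruple `(F_μ⁻¹(u), F_μ⁻¹(φ(u)), κ_{F_μ⁻¹(u)}, κ_{F_μ⁻¹(φ(u))})`. -/
def quad (μ : Measure ℝ) (κ : Kernel ℝ ℝ) (u : ℝ) : ℝ × ℝ × Measure ℝ × Measure ℝ :=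
  (quantile μ u, quantile μ (phi μ κ u), κ (quantile μ u), κ (quantile μ (phi μ κ u)))

/-- The family `m_u`: exchanged laws on `A⁺ ∪ A⁻`, and `κ_{F_μ⁻¹(u)}` elsewhere. -/
def mker (β β' : ℝ × ℝ × Measure ℝ × Measure ℝ → Measure ℝ) (μ : Measure ℝ) (κ : Kernel ℝ ℝ)
    (u : ℝ) : Measure ℝ :=
  open scoped Classical in
  if u ∈ APos μ κ then β (quad μ κ u)
  else if u ∈ ANeg μ κ then β' (quad μ κ (phi μ κ u))
  else κ (quantile μ u)

/-- The lifted measure `M̂ = λ_(0,1)(du) δ_{F_μ⁻¹(u)}(dx) m_u(dy)`. -/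
def Mhat (β β' : ℝ × ℝ × Measure ℝ × Measure ℝ → Measure ℝ) (μ : Measure ℝ) (κ : Kernel ℝ ℝ) :
    Measure (ℝ × ℝ × ℝ) :=
  lift μ (mker β β' μ κ)

end MartRearr

end

open MartRearr

/-! The distance from `iota μ κ` to the lifted martingale couplings is bounded below by a defect of
means, and the exchanged kernel attains this bound.

Lower bound. Over two levels u, u' the fibres are at adapted distance |F⁻¹(u) - F⁻¹(u')| + W₁
(`AW1_dirac_prod`), and W₁ is at least the difference of the means, |G(u) - F⁻¹(u')|. The triangle
inequality leaves |G(u) - F⁻¹(u)|, whatever the coupling of the levels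
(`le_liftedAW1_of_martingale`).

Upper bound. Along the diagonal coupling the cost is the integral of W₁ between old and new laws,
and W₁ equals the difference of means once the two laws are stochastically ordered
(`W1_eq_of_stochLE`). So it suffices that the new laws have means F⁻¹(u), are comparable with the
old ones, and still average to ν.

Levels whose mean must rise (𝒰⁺) are paired with levels whose mean must fall (𝒰⁻) by the monotone
transport φ from the density (F⁻¹ - G)⁺ to (F⁻¹ - G)⁻. Both have the same mass because μ and ν have
the same mean, and φ is almost everywhere invertible (`transport_inverse_ae`). The infinitesimal
lengths at u and φ(u) are in the ratio p : 1 - p, so an exchange preserving the mixture p η + (1 -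
p) η̃ preserves the average ν (`setLIntegral_ANeg`, `lintegral_mker`). Barycentre dispersion means
Δ₋ ≤ Δ₊, which puts the partner of u ∈ A⁺ to its right; hence F⁻¹(u) ≤ F⁻¹(φ(u)) and the exchange
maps apply (`le_phi`, `quad_mem`).

The explicit exchange swaps the bottom mass q of p η with the top mass q of (1 - p) η̃. The gain in
mean is the primitive of the nonincreasing function `gap`. At the largest q it exceeds the required
p (y - x), because x < y ≤ ỹ < x̃. Up to the first hitting q⋆ every swap moves mass of η upwards,
which gives the stochastic order. -/

namespace MartRearr

/-! ### Quantile functions -/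

instance : IsProbabilityMeasure lam := ⟨by simp [lam]⟩

instance : NullSingletonClass lam := by unfold lam; infer_instance

lemma ae_lam_mem : ∀ᵐ u ∂lam, u ∈ Ioo (0 : ℝ) 1 := ae_restrict_mem measurableSet_Ioo

lemma lam_Iic {t : ℝ} (h1 : t ≤ 1) : lam (Iic t) = ENNReal.ofReal t := by
  have : lam (Iic t) = lam (Iio t) := measure_congr Iio_ae_eq_Iic.symm
  rw [this, lam, Measure.restrict_apply measurableSet_Iio,
    show Iio t ∩ Ioo (0 : ℝ) 1 = Ioo 0 t by ext; simp; grind]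
  simp

/-- Right continuity of the distribution function makes the infimum attained. Existence of `z` is
assumed in place of `u < 1` so that the case u = 1 is also covered in `measurable_quantile_kernel`.
-/
lemma quantile_le_iff_of_exists {η : Measure ℝ} [IsProbabilityMeasure η] {u x : ℝ} (hu : 0 < u)
    (hne : ∃ z, u ≤ η.real (Iic z)) : quantile η u ≤ x ↔ u ≤ η.real (Iic x) := by
  have hmono : Monotone fun x => η.real (Iic x) := fun a b h =>
    measureReal_mono (Iic_subset_Iic.2 h)
  have hbdd : BddBelow {x : ℝ | u ≤ η.real (Iic x)} := by
    have h := (tendsto_cdf_atBot η).eventually (gt_mem_nhds hu)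
    obtain ⟨z, hz⟩ := h.exists
    refine ⟨z, fun w hw => ?_⟩
    by_contra! hlt
    have := hmono hlt.le
    rw [cdf_eq_real] at hz
    simp only [mem_ofPred_eq] at hw
    simp only at this
    linarith
  constructor
  · intro h
    have hlim : Filter.Tendsto (fun x => η.real (Iic x)) (nhdsWithin x (Ioi x))
        (nhds (η.real (Iic x))) := by
      have := ((cdf η).right_continuous x).mono_left
        (nhdsWithin_mono x (Ioi_subset_Ici_self (a := x)))
      simpa only [funext (cdf_eq_real η)] using this
    refine ge_of_tendsto hlim ?_
    filter_upwards [self_mem_nhdsWithin] with x' hx'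
    obtain ⟨s, hs, hsx⟩ := exists_lt_of_csInf_lt hne (lt_of_le_of_lt h hx')
    exact le_trans hs (hmono hsx.le)
  · intro h
    exact csInf_le hbdd h

lemma exists_le_cdf {η : Measure ℝ} [IsProbabilityMeasure η] {u : ℝ} (hu : u < 1) :
    ∃ z, u ≤ η.real (Iic z) := by
  obtain ⟨z, hz⟩ := ((tendsto_cdf_atTop η).eventually (lt_mem_nhds hu)).exists
  exact ⟨z, by rw [cdf_eq_real] at hz; exact hz.le⟩

lemma quantile_le_iff {η : Measure ℝ} [IsProbabilityMeasure η] {u x : ℝ}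
    (hu : u ∈ Ioo (0 : ℝ) 1) : quantile η u ≤ x ↔ u ≤ η.real (Iic x) :=
  quantile_le_iff_of_exists hu.1 (exists_le_cdf hu.2)

lemma quantile_mono (η : Measure ℝ) [IsProbabilityMeasure η] :
    MonotoneOn (quantile η) (Ioo 0 1) := fun _ hu _ hv huv =>
  (quantile_le_iff hu).2 (huv.trans ((quantile_le_iff hv).1 le_rfl))

lemma quantile_of_nonpos {η : Measure ℝ} {u : ℝ} (hu : u ≤ 0) : quantile η u = 0 := by
  have : {x : ℝ | u ≤ η.real (Iic x)} = univ :=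
    eq_univ_of_forall fun x => hu.trans measureReal_nonneg
  rw [quantile, this, Real.sInf_univ]

/-- Quantiles depend measurably on the law and the level. -/
lemma measurable_quantile_kernel {X : Type*} [MeasurableSpace X] (κ : Kernel X ℝ)
    [IsMarkovKernel κ] : Measurable fun z : X × ℝ => quantile (κ z.1) z.2 := by
  have hm : ∀ x : ℝ, MeasurableSet {z : X × ℝ | z.2 ≤ (κ z.1).real (Iic x)} := fun x =>
    measurableSet_le measurable_snd
      (((Kernel.measurable_coe κ measurableSet_Iic).comp measurable_fst).ennreal_toReal)
  set E : Set (X × ℝ) := {z | 0 < z.2} ∩ ⋃ n : ℕ, {z : X × ℝ | z.2 ≤ (κ z.1).real (Iic (n : ℝ))}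
    with hE
  have hEm : MeasurableSet E :=
    (measurableSet_lt measurable_const measurable_snd).inter (MeasurableSet.iUnion fun n => hm n)
  -- Off `E` the infimum runs over all of ℝ or over the empty set, and `sInf` takes the default
  -- value 0 in both cases.
  have hout : ∀ z ∉ E, quantile (κ z.1) z.2 = 0 := by
    intro z hz
    by_cases h0 : z.2 ≤ 0
    · exact quantile_of_nonpos h0
    have : {x : ℝ | z.2 ≤ (κ z.1).real (Iic x)} = ∅ := by
      refine eq_empty_of_forall_notMem fun x hx => hz ⟨not_le.1 h0, ?_⟩
      obtain ⟨n, hn⟩ := exists_nat_ge x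
      exact mem_iUnion.2 ⟨n, le_trans hx (measureReal_mono (Iic_subset_Iic.2 hn))⟩
    rw [quantile, this, Real.sInf_empty]
  refine measurable_of_Iic fun x => ?_
  have : (fun z : X × ℝ => quantile (κ z.1) z.2) ⁻¹' Iic x =
      (E ∩ {z | z.2 ≤ (κ z.1).real (Iic x)}) ∪ (Eᶜ ∩ {_z | 0 ≤ x}) := by
    ext z
    by_cases hz : z ∈ E
    · have := quantile_le_iff_of_exists (η := κ z.1) (x := x) hz.1
        (by obtain ⟨n, hn⟩ := mem_iUnion.1 hz.2; exact ⟨n, hn⟩)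
      simp [hz, this]
    · simp [hz, hout z hz]
  rw [this]
  exact (hEm.inter (hm x)).union (hEm.compl.inter (MeasurableSet.const _))

lemma measurable_quantile (η : Measure ℝ) [IsProbabilityMeasure η] : Measurable (quantile η) :=
  (measurable_quantile_kernel (Kernel.const Unit η)).comp (measurable_const.prodMk measurable_id
    : Measurable fun u : ℝ => ((), u))

lemma map_quantile (η : Measure ℝ) [IsProbabilityMeasure η] : lam.map (quantile η) = η := by
  have := Measure.isProbabilityMeasure_map (μ := lam) (measurable_quantile η).aemeasurable
  refine Measure.ext_of_Iic _ _ fun x => ?_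
  rw [Measure.map_apply (measurable_quantile η) measurableSet_Iic]
  have : quantile η ⁻¹' Iic x =ᵐ[lam] Iic (η.real (Iic x)) := by
    filter_upwards [ae_lam_mem] with u hu
    exact propext (quantile_le_iff hu)
  rw [measure_congr this, lam_Iic measureReal_le_one, ofReal_measureReal]

lemma integral_id_map {X : Type*} [MeasurableSpace X] {ρ : Measure X} {f : X → ℝ}
    (hf : AEMeasurable f ρ) : ∫ w, w ∂(ρ.map f) = ∫ z, f z ∂ρ :=
  integral_map hf aestronglyMeasurable_id

lemma integral_quantile (η : Measure ℝ) [IsProbabilityMeasure η] :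
    ∫ u, quantile η u ∂lam = ∫ w, w ∂η := by
  conv_rhs => rw [← map_quantile η]
  rw [integral_id_map (measurable_quantile η).aemeasurable]

lemma integrable_quantile {η : Measure ℝ} (h : IsP1 η) : Integrable (quantile η) lam := by
  have := h.1
  have h2 := h.2
  rw [← map_quantile η] at h2
  exact (integrable_map_measure aestronglyMeasurable_id
    (measurable_quantile η).aemeasurable).1 h2

lemma stochLE_of_measure_le {η η' : Measure ℝ} [IsProbabilityMeasure η] [IsProbabilityMeasure η']
    (h : ∀ x, η' (Iic x) ≤ η (Iic x)) : StochLE η η' := fun u hu => by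
  rw [quantile_le_iff hu]
  exact ((quantile_le_iff hu).1 le_rfl).trans
    (ENNReal.toReal_mono (measure_ne_top _ _) (h _))

/-! ### The Wasserstein distance on the line -/

lemma W1_le_lintegral_quantile (η η' : Measure ℝ) [IsProbabilityMeasure η]
    [IsProbabilityMeasure η'] :
    W1 η η' ≤ ∫⁻ u, ENNReal.ofReal |quantile η u - quantile η' u| ∂lam := by
  have hm : Measurable fun u => (quantile η u, quantile η' u) :=
    (measurable_quantile η).prodMk (measurable_quantile η')
  have hc : IsCoupling η η' (lam.map fun u => (quantile η u, quantile η' u)) := by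
    constructor
    · rw [Measure.map_map measurable_fst hm]; exact map_quantile η
    · rw [Measure.map_map measurable_snd hm]; exact map_quantile η'
  refine (iInf₂_le _ hc).trans ?_
  rw [lintegral_map (by fun_prop) hm]

lemma W1_self (η : Measure ℝ) [IsProbabilityMeasure η] : W1 η η = 0 :=
  le_antisymm ((W1_le_lintegral_quantile η η).trans (by simp)) zero_le

lemma ofReal_abs_mean_sub_le_W1 {η η' : Measure ℝ} (h : IsP1 η) (h' : IsP1 η') :
    ENNReal.ofReal |∫ w, w ∂η - ∫ w, w ∂η'| ≤ W1 η η' := by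
  refine le_iInf₂ fun χ hχ => ?_
  have h1 : Integrable (fun z : ℝ × ℝ => z.1) χ := by
    have := h.2
    rw [← hχ.1] at this
    exact (integrable_map_measure aestronglyMeasurable_id measurable_fst.aemeasurable).1 this
  have h2 : Integrable (fun z : ℝ × ℝ => z.2) χ := by
    have := h'.2
    rw [← hχ.2] at this
    exact (integrable_map_measure aestronglyMeasurable_id measurable_snd.aemeasurable).1 this
  have e1 : ∫ w, w ∂η = ∫ z, z.1 ∂χ := by
    rw [← hχ.1, integral_id_map measurable_fst.aemeasurable]
  have e2 : ∫ w, w ∂η' = ∫ z, z.2 ∂χ := by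
    rw [← hχ.2, integral_id_map measurable_snd.aemeasurable]
  have e3 := ofReal_integral_eq_lintegral_ofReal (h1.sub h2).abs (.of_forall fun _ => abs_nonneg _)
  rw [e1, e2, ← integral_sub h1 h2]
  exact (ENNReal.ofReal_le_ofReal abs_integral_le_integral_abs).trans e3.le

lemma lintegral_quantile_sub_of_stochLE {η η' : Measure ℝ} (h : IsP1 η) (h' : IsP1 η')
    (hst : StochLE η η') : ∫⁻ u, ENNReal.ofReal |quantile η' u - quantile η u| ∂lam =
      ENNReal.ofReal |∫ w, w ∂η' - ∫ w, w ∂η| := by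
  have := h.1
  have := h'.1
  have hi := (integrable_quantile h').sub (integrable_quantile h)
  have hnn : 0 ≤ᵐ[lam] (quantile η' - quantile η) := by
    filter_upwards [ae_lam_mem] with u hu using sub_nonneg.2 (hst u hu)
  rw [← integral_quantile, ← integral_quantile,
    ← integral_sub' (integrable_quantile h') (integrable_quantile h),
    abs_of_nonneg (integral_nonneg_of_ae hnn)]
  refine Eq.trans (lintegral_congr_ae ?_) (ofReal_integral_eq_lintegral_ofReal hi hnn).symm
  filter_upwards [hnn] with u hu
  rw [← Pi.sub_apply, abs_of_nonneg hu]

/-- The order fixes the sign of the difference of the quantiles, so the absolute value leaves the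
integral and the quantile coupling already attains the lower bound by means. -/
lemma W1_eq_of_stochLE {η η' : Measure ℝ} (h : IsP1 η) (h' : IsP1 η')
    (hst : StochLE η η' ∨ StochLE η' η) : W1 η η' = ENNReal.ofReal |∫ w, w ∂η - ∫ w, w ∂η'| := by
  have := h.1
  have := h'.1
  refine le_antisymm ((W1_le_lintegral_quantile η η').trans ?_) (ofReal_abs_mean_sub_le_W1 h h')
  rcases hst with hst | hst
  · simp only [abs_sub_comm (quantile η _), abs_sub_comm (∫ w, w ∂η)]
    exact (lintegral_quantile_sub_of_stochLE h h' hst).le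
  · exact (lintegral_quantile_sub_of_stochLE h' h hst).le

/-! ### Lifts and the lifted adapted Wasserstein distance -/

/-- The kernel `u ↦ δ_{F_μ⁻¹(u)} × p_u`. -/
noncomputable def liftKernel (μ : Measure ℝ) [IsProbabilityMeasure μ] (p : Kernel ℝ ℝ) :
    Kernel ℝ (ℝ × ℝ) :=
  Kernel.deterministic (quantile μ) (measurable_quantile μ) ×ₖ p

instance (μ : Measure ℝ) [IsProbabilityMeasure μ] (p : Kernel ℝ ℝ) [IsMarkovKernel p] :
    IsMarkovKernel (liftKernel μ p) := by
  unfold liftKernel; infer_instance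

lemma liftKernel_apply (μ : Measure ℝ) [IsProbabilityMeasure μ] (p : Kernel ℝ ℝ)
    [IsMarkovKernel p] (u : ℝ) :
    liftKernel μ p u = (Measure.dirac (quantile μ u)).prod (p u) := by
  rw [liftKernel, Kernel.prod_apply, Kernel.deterministic_apply]

lemma lift_eq_compProd (μ : Measure ℝ) [IsProbabilityMeasure μ] (p : Kernel ℝ ℝ)
    [IsMarkovKernel p] : lift μ p = lam ⊗ₘ liftKernel μ p := by
  rw [Measure.compProd_eq_comp_prod, lift]
  congr 1
  funext u
  rw [Kernel.prod_apply, Kernel.id_apply, liftKernel_apply]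

section LiftedDistance

variable {μ : Measure ℝ} [IsProbabilityMeasure μ] {p : Kernel ℝ ℝ} [IsMarkovKernel p]

lemma map_fst_lift : (lift μ p).map Prod.fst = lam := by
  rw [lift_eq_compProd]
  exact Measure.fst_compProd lam (liftKernel μ p)

lemma map_snd_lift : (lift μ p).map Prod.snd = lam.bind (liftKernel μ p) := by
  rw [lift_eq_compProd]
  exact Measure.snd_compProd lam (liftKernel μ p)

lemma map_fst_map_snd_lift : ((lift μ p).map Prod.snd).map Prod.fst = μ := by
  ext s hs
  rw [map_snd_lift, Measure.map_apply measurable_fst hs,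
    Measure.bind_apply (measurable_fst hs) (Kernel.aemeasurable _)]
  conv_rhs => rw [← map_quantile μ, Measure.map_apply (measurable_quantile μ) hs,
    ← lintegral_indicator_one (measurable_quantile μ hs)]
  refine lintegral_congr fun u => ?_
  rw [liftKernel_apply, ← prod_univ, Measure.prod_prod, Measure.dirac_apply' _ hs]
  rw [measure_univ, mul_one]
  rfl

lemma map_snd_map_snd_lift : ((lift μ p).map Prod.snd).map Prod.snd = lam.bind p := by
  ext s hs
  rw [map_snd_lift, Measure.map_apply measurable_snd hs,
    Measure.bind_apply (measurable_snd hs) (Kernel.aemeasurable _),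
    Measure.bind_apply hs (Kernel.aemeasurable _)]
  refine lintegral_congr fun u => ?_
  rw [liftKernel_apply, ← univ_prod, Measure.prod_prod]
  simp

lemma disint_lift : ∀ᵐ u ∂lam,
    disint (lift μ p) u = (Measure.dirac (quantile μ u)).prod (p u) := by
  have h := condKernel_compProd lam (liftKernel μ p)
  filter_upwards [h] with u hu
  rw [lift_eq_compProd, disint,
    dif_pos (inferInstanceAs (IsFiniteMeasure (lam ⊗ₘ liftKernel μ p))), hu, liftKernel_apply]

lemma disint_dirac_prod (x : ℝ) (η : Measure ℝ) [IsProbabilityMeasure η] :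
    disint ((Measure.dirac x).prod η) x = η := by
  have h := condKernel_compProd (Measure.dirac x) (Kernel.const ℝ η)
  rw [Filter.EventuallyEq, ae_dirac_eq, Filter.eventually_pure, Kernel.const_apply] at h
  rw [← Measure.compProd_const, disint,
    dif_pos (inferInstanceAs (IsFiniteMeasure (Measure.dirac x ⊗ₘ Kernel.const ℝ η))), h]

/-- A coupling of two Dirac masses sits at the single point (x, x'). Disintegrations, in general
only defined almost everywhere, are determined at an atom. -/
lemma AW1_dirac_prod (x x' : ℝ) (η η' : Measure ℝ) [IsProbabilityMeasure η]
    [IsProbabilityMeasure η'] :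
    AW1 ((Measure.dirac x).prod η) ((Measure.dirac x').prod η') =
      ENNReal.ofReal |x - x'| + W1 η η' := by
  have hmap : ∀ (x : ℝ) (η : Measure ℝ) [IsProbabilityMeasure η],
      ((Measure.dirac x).prod η).map Prod.fst = Measure.dirac x := fun x η _ => by
    exact Measure.fst_prod
  have key : ∀ χ : Measure (ℝ × ℝ), IsCoupling (Measure.dirac x) (Measure.dirac x') χ →
      ∫⁻ z, (ENNReal.ofReal |z.1 - z.2| + W1 (disint ((Measure.dirac x).prod η) z.1)
        (disint ((Measure.dirac x').prod η') z.2)) ∂χ = ENNReal.ofReal |x - x'| + W1 η η' := by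
    intro χ hχ
    have h1 : ∀ᵐ z ∂χ, z.1 = x := by
      refine ae_of_ae_map (f := Prod.fst) (p := fun w => w = x) measurable_fst.aemeasurable ?_
      rw [hχ.1, ae_dirac_eq]; exact rfl
    have h2 : ∀ᵐ z ∂χ, z.2 = x' := by
      refine ae_of_ae_map (f := Prod.snd) (p := fun w => w = x') measurable_snd.aemeasurable ?_
      rw [hχ.2, ae_dirac_eq]; exact rfl
    have huniv : χ univ = 1 := by
      have := congrArg (fun ρ => ρ univ) hχ.1
      simpa [Measure.map_apply measurable_fst MeasurableSet.univ] using this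
    have : ∀ᵐ z ∂χ, (ENNReal.ofReal |z.1 - z.2| + W1 (disint ((Measure.dirac x).prod η) z.1)
        (disint ((Measure.dirac x').prod η') z.2)) = ENNReal.ofReal |x - x'| + W1 η η' := by
      filter_upwards [h1, h2] with z e1 e2
      rw [e1, e2, disint_dirac_prod, disint_dirac_prod]
    rw [lintegral_congr_ae this, lintegral_const, huniv, mul_one]
  unfold AW1
  rw [hmap, hmap]
  refine le_antisymm ?_ (le_iInf₂ fun χ hχ => (key χ hχ).ge)
  have hc : IsCoupling (Measure.dirac x) (Measure.dirac x') (Measure.dirac (x, x')) :=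
    ⟨Measure.map_dirac' measurable_fst _, Measure.map_dirac' measurable_snd _⟩
  exact (iInf₂_le _ hc).trans (key _ hc).le

/-- The diagonal coupling bounds the lifted distance between two lifts over the same measure. -/
lemma liftedAW1_lift_le {p' : Kernel ℝ ℝ} [IsMarkovKernel p'] :
    liftedAW1 (lift μ p) (lift μ p') ≤ ∫⁻ u, W1 (p u) (p' u) ∂lam := by
  have hm : Measurable fun u : ℝ => (u, u) := measurable_id.prodMk measurable_id
  -- The integrand is built from infima over couplings, whose measurability is not established;
  -- along a measurable embedding the change of variables does not need it.
  have hemb : MeasurableEmbedding fun u : ℝ => (u, u) :=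
    hm.measurableEmbedding fun _ _ h => (Prod.ext_iff.1 h).1
  have hc : IsCoupling ((lift μ p).map Prod.fst) ((lift μ p').map Prod.fst)
      (lam.map fun u => (u, u)) := by
    rw [map_fst_lift, map_fst_lift]
    constructor
    · rw [Measure.map_map measurable_fst hm]; exact Measure.map_id
    · rw [Measure.map_map measurable_snd hm]; exact Measure.map_id
  refine (iInf₂_le _ hc).trans (le_of_eq ?_)
  rw [hemb.lintegral_map]
  refine lintegral_congr_ae ?_
  filter_upwards [disint_lift (μ := μ) (p := p), disint_lift (μ := μ) (p := p')] with u h1 h2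
  rw [h1, h2, AW1_dirac_prod]
  simp

/-- Any lifted martingale coupling is at least as far as the mean defect. -/
lemma le_liftedAW1_of_martingale {p' : Kernel ℝ ℝ} [IsMarkovKernel p'] {g : ℝ → ℝ}
    (hg : Measurable g) (hp : ∀ᵐ u ∂lam, Integrable (fun y : ℝ => y) (p u) ∧ ∫ y, y ∂(p u) = g u)
    (hp' : ∀ᵐ u ∂lam, Integrable (fun y : ℝ => y) (p' u) ∧ ∫ y, y ∂(p' u) = quantile μ u) :
    ∫⁻ u, ENNReal.ofReal |g u - quantile μ u| ∂lam ≤ liftedAW1 (lift μ p) (lift μ p') := by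
  refine le_iInf₂ fun χ hχ => ?_
  rw [map_fst_lift, map_fst_lift] at hχ
  have hmeas : Measurable fun u => ENNReal.ofReal |g u - quantile μ u| :=
    ((hg.sub (measurable_quantile μ)).abs).ennreal_ofReal
  have e : ∫⁻ u, ENNReal.ofReal |g u - quantile μ u| ∂lam =
      ∫⁻ z, ENNReal.ofReal |g z.1 - quantile μ z.1| ∂χ := by
    conv_lhs => rw [← hχ.1]
    rw [lintegral_map hmeas measurable_fst]
  rw [e]
  have h1 : ∀ᵐ z ∂χ, disint (lift μ p) z.1 = (Measure.dirac (quantile μ z.1)).prod (p z.1) ∧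
      (Integrable (fun y : ℝ => y) (p z.1) ∧ ∫ y, y ∂(p z.1) = g z.1) := by
    refine ae_of_ae_map (f := Prod.fst) (p := fun u => disint (lift μ p) u =
      (Measure.dirac (quantile μ u)).prod (p u) ∧ (Integrable (fun y : ℝ => y) (p u) ∧
        ∫ y, y ∂(p u) = g u)) measurable_fst.aemeasurable ?_
    rw [hχ.1]; exact disint_lift.and hp
  have h2 : ∀ᵐ z ∂χ, disint (lift μ p') z.2 = (Measure.dirac (quantile μ z.2)).prod (p' z.2) ∧
      (Integrable (fun y : ℝ => y) (p' z.2) ∧ ∫ y, y ∂(p' z.2) = quantile μ z.2) := by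
    refine ae_of_ae_map (f := Prod.snd) (p := fun u => disint (lift μ p') u =
      (Measure.dirac (quantile μ u)).prod (p' u) ∧ (Integrable (fun y : ℝ => y) (p' u) ∧
        ∫ y, y ∂(p' u) = quantile μ u)) measurable_snd.aemeasurable ?_
    rw [hχ.2]; exact disint_lift.and hp'
  refine lintegral_mono_ae ?_
  filter_upwards [h1, h2] with z a b
  rw [a.1, b.1, AW1_dirac_prod]
  have hW := ofReal_abs_mean_sub_le_W1 (η := p z.1) (η' := p' z.2) ⟨inferInstance, a.2.1⟩
    ⟨inferInstance, b.2.1⟩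
  rw [a.2.2, b.2.2] at hW
  -- The fibre term |F⁻¹(u) - F⁻¹(u')| pays for leaving the diagonal, so the term |u - u'| can be
  -- dropped at the end.
  calc ENNReal.ofReal |g z.1 - quantile μ z.1|
      ≤ ENNReal.ofReal (|quantile μ z.1 - quantile μ z.2| + |g z.1 - quantile μ z.2|) := by
        refine ENNReal.ofReal_le_ofReal ?_
        rw [add_comm, abs_sub_comm (quantile μ z.1)]
        exact abs_sub_le _ _ _
    _ = ENNReal.ofReal |quantile μ z.1 - quantile μ z.2| +
        ENNReal.ofReal |g z.1 - quantile μ z.2| :=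
        ENNReal.ofReal_add (abs_nonneg _) (abs_nonneg _)
    _ ≤ ENNReal.ofReal |quantile μ z.1 - quantile μ z.2| + W1 (p z.1) (p' z.2) := by gcongr
    _ ≤ _ := le_add_self

end LiftedDistance

/-! ### First hitting of a level by the primitive of a nonincreasing function -/

section Hitting

variable {f : ℝ → ℝ} {c k : ℝ}

lemma continuousOn_primitive (hc : 0 ≤ c) (hi : IntervalIntegrable f volume 0 c) :
    ContinuousOn (fun q => ∫ s in (0 : ℝ)..q, f s) (Icc 0 c) := by
  have := intervalIntegral.continuousOn_primitive_interval (a := 0) (b := c) (f := f)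
    (μ := volume) (by rw [uIcc_of_le hc]; exact (intervalIntegrable_iff_integrableOn_Icc_of_le hc).1 hi)
  rwa [uIcc_of_le hc] at this

lemma intervalIntegrable_sub (hi : IntervalIntegrable f volume 0 c) {a b : ℝ}
    (ha : 0 ≤ a) (hab : a ≤ b) (hb : b ≤ c) : IntervalIntegrable f volume a b :=
  hi.mono_set (by
    rw [uIcc_of_le hab, uIcc_of_le (ha.trans (hab.trans hb))]; exact Icc_subset_Icc ha hb)

lemma hitting_spec (hc : 0 ≤ c) (hi : IntervalIntegrable f volume 0 c) (hk : 0 ≤ k)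
    (hkc : k ≤ ∫ s in (0 : ℝ)..c, f s) :
    IsLeast {q | q ∈ Icc 0 c ∧ ∫ s in (0 : ℝ)..q, f s = k}
      (sInf {q | q ∈ Icc 0 c ∧ ∫ s in (0 : ℝ)..q, f s = k}) := by
  have hcont := continuousOn_primitive hc hi
  have hcl : IsClosed {q | q ∈ Icc 0 c ∧ ∫ s in (0 : ℝ)..q, f s = k} :=
    hcont.preimage_isClosed_of_isClosed isClosed_Icc isClosed_singleton
  have hne : {q | q ∈ Icc 0 c ∧ ∫ s in (0 : ℝ)..q, f s = k}.Nonempty := by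
    obtain ⟨q, hq, he⟩ := intermediate_value_Icc hc hcont ⟨by simpa using hk, hkc⟩
    exact ⟨q, hq, he⟩
  have hbdd : BddBelow {q | q ∈ Icc 0 c ∧ ∫ s in (0 : ℝ)..q, f s = k} := ⟨0, fun q hq => hq.1.1⟩
  exact ⟨hcl.csInf_mem hne hbdd, fun q hq => csInf_le hbdd hq⟩

/-- Past a point where the integrand is negative the primitive only decreases. -/
lemma primitive_le_of_neg (hi : IntervalIntegrable f volume 0 c) (hf : AntitoneOn f (Ioo 0 c))
    {s q : ℝ} (hs : 0 < s) (hsq : s ≤ q) (hqc : q ≤ c) (hneg : f s ≤ 0) :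
    ∫ t in (0 : ℝ)..c, f t ≤ ∫ t in (0 : ℝ)..q, f t := by
  rw [← intervalIntegral.integral_add_adjacent_intervals
    (intervalIntegrable_sub hi le_rfl (hs.le.trans hsq) hqc)
    (intervalIntegrable_sub hi (hs.le.trans hsq) hqc le_rfl)]
  have := intervalIntegral.integral_mono_on_of_le_Ioo hqc
    (intervalIntegrable_sub hi (hs.le.trans hsq) hqc le_rfl)
    (g := fun _ => (0 : ℝ)) intervalIntegrable_const (fun t ht =>
      (hf ⟨hs, lt_of_le_of_lt hsq (ht.1.trans ht.2)⟩ ⟨hs.trans_le (hsq.trans ht.1.le), ht.2⟩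
        (hsq.trans ht.1.le)).trans hneg)
  simp only [intervalIntegral.integral_zero] at this
  linarith

/-- A negative value before `q` would keep the primitive nonincreasing from `q` on, so that it could
not end strictly above `k`. -/
lemma nonneg_before_hitting (hi : IntervalIntegrable f volume 0 c) (hf : AntitoneOn f (Ioo 0 c))
    (hkc : k < ∫ s in (0 : ℝ)..c, f s) {q : ℝ} (hq : q ∈ Icc 0 c)
    (he : ∫ s in (0 : ℝ)..q, f s = k) {s : ℝ} (hs : s ∈ Ioo 0 q) : 0 ≤ f s := by
  by_contra! hneg
  have := primitive_le_of_neg hi hf hs.1 hs.2.le hq.2 hneg.le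
  linarith

/-- The primitive of a nonincreasing function is concave; since it ends strictly above `k`, it never
falls below `k` again after reaching it. Sublevel sets of the hitting point thus become inequalities
between integrals, which is what measurability of `qStar` requires. -/
lemma hitting_le_iff (hc : 0 ≤ c) (hi : IntervalIntegrable f volume 0 c)
    (hf : AntitoneOn f (Ioo 0 c)) (hk : 0 ≤ k) (hkc : k < ∫ s in (0 : ℝ)..c, f s)
    {q : ℝ} (hq : q ∈ Icc 0 c) :
    sInf {q | q ∈ Icc 0 c ∧ ∫ s in (0 : ℝ)..q, f s = k} ≤ q ↔ k ≤ ∫ s in (0 : ℝ)..q, f s := by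
  obtain ⟨⟨hmem, he⟩, hleast⟩ := hitting_spec hc hi hk hkc.le
  constructor
  · intro hle
    -- If `f` is negative somewhere before `q`, the primitive at `q` is at least its final value;
    -- otherwise it is nondecreasing between the hitting point and `q`.
    by_cases h : ∃ s ∈ Ioo 0 q, f s < 0
    · obtain ⟨s, hs, hneg⟩ := h
      exact hkc.le.trans (primitive_le_of_neg hi hf hs.1 hs.2.le hq.2 hneg.le)
    · push Not at h
      have := intervalIntegral.integral_mono_on_of_le_Ioo hle
        (f := fun _ => (0 : ℝ)) intervalIntegrable_const
        (intervalIntegrable_sub hi hmem.1 hle hq.2) (fun t ht =>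
          h t ⟨hmem.1.trans_lt ht.1, ht.2⟩)
      simp only [intervalIntegral.integral_zero] at this
      rw [← intervalIntegral.integral_add_adjacent_intervals
        (intervalIntegrable_sub hi le_rfl hmem.1 hmem.2)
        (intervalIntegrable_sub hi hmem.1 hle hq.2)]
      linarith
  · intro hle
    obtain ⟨r, hr, he'⟩ := intermediate_value_Icc hq.1
      ((continuousOn_primitive hc hi).mono (Icc_subset_Icc_right hq.2)) ⟨by simpa using hk, hle⟩
    exact (hleast ⟨⟨hr.1, hr.2.trans hq.2⟩, he'⟩).trans hr.2

end Hitting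

/-! ### The gap between upper quantiles and lower quantiles -/

/-- Gain in mean per unit of mass, when the mass at level `s` from the bottom of `p η` is replaced
with the mass at level `s` from the top of `(1 - p) η'`. -/
noncomputable def gap (η η' : Measure ℝ) (p s : ℝ) : ℝ :=
  quantile η' (1 - s / (1 - p)) - quantile η (s / p)

section Gap

variable {η η' : Measure ℝ} {p : ℝ}

lemma intervalIntegrable_quantile (h : IsP1 η) : IntervalIntegrable (quantile η) volume 0 1 :=
  (intervalIntegrable_iff_integrableOn_Ioo_of_le zero_le_one).2 (integrable_quantile h)

lemma intervalIntegral_quantile (h : IsP1 η) : ∫ u in (0 : ℝ)..1, quantile η u = ∫ w, w ∂η := by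
  have := h.1
  rw [← integral_quantile, intervalIntegral.integral_of_le zero_le_one,
    integral_Ioc_eq_integral_Ioo, lam]

lemma intervalIntegrable_quantile_div (h : IsP1 η) (p : ℝ) :
    IntervalIntegrable (fun s => quantile η (s / p)) volume 0 p := by
  have := (intervalIntegrable_quantile h).comp_mul_left (c := p⁻¹)
  simpa [div_eq_inv_mul] using this

lemma intervalIntegrable_quantile_sub_div (h : IsP1 η) (p : ℝ) :
    IntervalIntegrable (fun s => quantile η (1 - s / p)) volume 0 p := by
  have := (((intervalIntegrable_quantile h).comp_sub_left 1).symm).comp_mul_left (c := p⁻¹)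
  simpa [div_eq_inv_mul] using this

lemma intervalIntegrable_gap (h : IsP1 η) (h' : IsP1 η') (hp : p ∈ Ioo (0 : ℝ) 1) :
    IntervalIntegrable (gap η η' p) volume 0 (min p (1 - p)) := by
  have hc : 0 ≤ min p (1 - p) := le_min hp.1.le (by linarith [hp.2])
  exact (intervalIntegrable_sub (intervalIntegrable_quantile_sub_div h' _) le_rfl hc
      (min_le_right _ _)).sub
    (intervalIntegrable_sub (intervalIntegrable_quantile_div h _) le_rfl hc (min_le_left _ _))

lemma div_mem_of_lt_min (hp : p ∈ Ioo (0 : ℝ) 1) {s : ℝ} (hs : s ∈ Ioo 0 (min p (1 - p))) :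
    s / p ∈ Ioo (0 : ℝ) 1 ∧ 1 - s / (1 - p) ∈ Ioo (0 : ℝ) 1 := by
  have h1 := hs.2.trans_le (min_le_left _ _)
  have h2 := hs.2.trans_le (min_le_right _ _)
  have hp' : 0 < 1 - p := sub_pos.2 hp.2
  have h3 : s / (1 - p) ∈ Ioo (0 : ℝ) 1 := ⟨div_pos hs.1 hp', (div_lt_one hp').2 h2⟩
  exact ⟨⟨div_pos hs.1 hp.1, (div_lt_one hp.1).2 h1⟩, by linarith [h3.2], by linarith [h3.1]⟩

lemma antitoneOn_gap [IsProbabilityMeasure η] [IsProbabilityMeasure η']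
    (hp : p ∈ Ioo (0 : ℝ) 1) : AntitoneOn (gap η η' p) (Ioo 0 (min p (1 - p))) := by
  intro s hs t ht hst
  have hp' : 0 < 1 - p := sub_pos.2 hp.2
  obtain ⟨hs1, hs2⟩ := div_mem_of_lt_min hp hs
  obtain ⟨ht1, ht2⟩ := div_mem_of_lt_min hp ht
  have a := quantile_mono η hs1 ht1 (div_le_div_of_nonneg_right hst hp.1.le)
  have b := quantile_mono η' ht2 hs2
    (sub_le_sub_left (div_le_div_of_nonneg_right hst hp'.le) 1)
  simp only [gap]
  linarith

/-- The bottom part of a law has average at most the mean: compressing the levels from (0, p) to (0,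
c) raises every quantile. -/
lemma integral_quantile_div_le (h : IsP1 η) {c : ℝ} (hc : 0 < c) (hcp : c ≤ p) :
    ∫ s in (0 : ℝ)..c, quantile η (s / p) ≤ c * ∫ w, w ∂η := by
  have := h.1
  have hp := hc.trans_le hcp
  have e1 : c * ∫ w, w ∂η = ∫ s in (0 : ℝ)..c, quantile η (s / c) := by
    rw [intervalIntegral.integral_comp_div _ hc.ne', zero_div, div_self hc.ne',
      intervalIntegral_quantile h, smul_eq_mul]
  rw [e1]
  refine intervalIntegral.integral_mono_on_of_le_Ioo hc.le
    (intervalIntegrable_sub (intervalIntegrable_quantile_div h _) le_rfl hc.le hcp)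
    (intervalIntegrable_quantile_div h _) fun s hs => ?_
  exact quantile_mono η ⟨div_pos hs.1 hp, (div_lt_one hp).2 (hs.2.trans_le hcp)⟩
    ⟨div_pos hs.1 hc, (div_lt_one hc).2 hs.2⟩ (div_le_div_of_nonneg_left hs.1.le hc hcp)

lemma le_integral_quantile_sub_div (h : IsP1 η) {c : ℝ} (hc : 0 < c) (hcp : c ≤ p) :
    c * ∫ w, w ∂η ≤ ∫ s in (0 : ℝ)..c, quantile η (1 - s / p) := by
  have := h.1
  have hp := hc.trans_le hcp
  have e1 : c * ∫ w, w ∂η = ∫ s in (0 : ℝ)..c, quantile η (1 - s / c) := by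
    rw [intervalIntegral.integral_comp_sub_div _ hc.ne', zero_div, div_self hc.ne', sub_self,
      sub_zero, intervalIntegral_quantile h, smul_eq_mul]
  rw [e1]
  refine intervalIntegral.integral_mono_on_of_le_Ioo hc.le
    (intervalIntegrable_quantile_sub_div h _)
    (intervalIntegrable_sub (intervalIntegrable_quantile_sub_div h _) le_rfl hc.le hcp)
    fun s hs => ?_
  have h1 : s / p ∈ Ioo (0 : ℝ) 1 := ⟨div_pos hs.1 hp, (div_lt_one hp).2 (hs.2.trans_le hcp)⟩
  have h2 : s / c ∈ Ioo (0 : ℝ) 1 := ⟨div_pos hs.1 hc, (div_lt_one hc).2 hs.2⟩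
  exact quantile_mono η ⟨by linarith [h2.2], by linarith [h2.1]⟩
    ⟨by linarith [h1.2], by linarith [h1.1]⟩
    (sub_le_sub_left (div_le_div_of_nonneg_left hs.1.le hc hcp) 1)

lemma integral_gap (h : IsP1 η) (h' : IsP1 η') {q : ℝ}
    (hq : q ∈ Icc 0 (min p (1 - p))) : ∫ s in (0 : ℝ)..q, gap η η' p s =
      (∫ s in (0 : ℝ)..q, quantile η' (1 - s / (1 - p))) -
        ∫ s in (0 : ℝ)..q, quantile η (s / p) :=
  intervalIntegral.integral_sub
    (intervalIntegrable_sub (intervalIntegrable_quantile_sub_div h' _) le_rfl hq.1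
      (hq.2.trans (min_le_right _ _)))
    (intervalIntegrable_sub (intervalIntegrable_quantile_div h _) le_rfl hq.1
      (hq.2.trans (min_le_left _ _)))

/-- A bottom part averages at most the mean of `η` and a top part at least the mean of `η'`. -/
lemma le_integral_gap (h : IsP1 η) (h' : IsP1 η') (hp : p ∈ Ioo (0 : ℝ) 1) :
    min p (1 - p) * (∫ w, w ∂η' - ∫ w, w ∂η) ≤ ∫ s in (0 : ℝ)..(min p (1 - p)), gap η η' p s := by
  have hc : 0 < min p (1 - p) := lt_min hp.1 (sub_pos.2 hp.2)
  rw [integral_gap h h' ⟨hc.le, le_rfl⟩]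
  have := integral_quantile_div_le h hc (min_le_left _ _)
  have := le_integral_quantile_sub_div h' hc (min_le_right _ _)
  linarith

end Gap

/-! ### The amount of exchanged mass -/

section Exchange

variable {b : ℝ × ℝ × Measure ℝ × Measure ℝ}

lemma weight_mem (hb : b ∈ quadruples) : weight b ∈ Ioo (0 : ℝ) 1 := by
  obtain ⟨-, -, h1, h2, h3⟩ := hb
  have hpos : 0 < b.1 - ∫ w, w ∂b.2.2.1 + ∫ w, w ∂b.2.2.2 - b.2.1 := by linarith
  exact ⟨div_pos (by linarith) hpos, (div_lt_one hpos).2 (by linarith)⟩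

/-- The total gain in mean `p (y - x)`. -/
noncomputable def gain (b : ℝ × ℝ × Measure ℝ × Measure ℝ) : ℝ :=
  weight b * (b.1 - ∫ w, w ∂b.2.2.1)

/-- The largest amount of mass that can be exchanged. -/
noncomputable def cap (b : ℝ × ℝ × Measure ℝ × Measure ℝ) : ℝ := min (weight b) (1 - weight b)

lemma gain_eq (hb : b ∈ quadruples) : gain b = (1 - weight b) * (∫ w, w ∂b.2.2.2 - b.2.1) := by
  obtain ⟨-, -, h1, h2, h3⟩ := hb
  have hpos : 0 < b.1 - ∫ w, w ∂b.2.2.1 + ∫ w, w ∂b.2.2.2 - b.2.1 := by linarith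
  simp only [gain, weight]
  field_simp
  ring

lemma gain_pos (hb : b ∈ quadruples) : 0 < gain b :=
  mul_pos (weight_mem hb).1 (by linarith [hb.2.2.1])

lemma cap_pos (hb : b ∈ quadruples) : 0 < cap b :=
  lt_min (weight_mem hb).1 (sub_pos.2 (weight_mem hb).2)

/-- The gain has the two forms p (y - x) and (1 - p) (x̃ - ỹ). The first is below p (x̃ - x) since y
< x̃, the second below (1 - p) (x̃ - x) since x < ỹ; both inequalities use y ≤ ỹ. -/
lemma gain_lt (hb : b ∈ quadruples) :
    gain b < ∫ s in (0 : ℝ)..(cap b), gap b.2.2.1 b.2.2.2 (weight b) s := by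
  refine lt_of_lt_of_le ?_ (le_integral_gap hb.1 hb.2.1 (weight_mem hb))
  obtain ⟨hw0, hw1⟩ := weight_mem hb
  have h1 := hb.2.2.1
  have h2 := hb.2.2.2.1
  have h3 := hb.2.2.2.2
  rw [min_mul_of_nonneg _ _ (by linarith)]
  refine lt_min ?_ ?_
  · rw [gain]
    exact mul_lt_mul_of_pos_left (by linarith) hw0
  · rw [gain_eq hb]
    exact mul_lt_mul_of_pos_left (by linarith) (by linarith)

/-- The substitution s = p u measures levels by mass, the common variable in which the bottom of p η
and the top of (1 - p) η̃ are compared. -/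
lemma fnJ_eq (hb : b ∈ quadruples) {q : ℝ} (hq : q ∈ Icc 0 (cap b)) :
    weight b * fnJ b q = weight b * ∫ w, w ∂b.2.2.1 +
      ∫ s in (0 : ℝ)..q, gap b.2.2.1 b.2.2.2 (weight b) s := by
  have hw := weight_mem hb
  have hw0 := hw.1.ne'
  have hqp : q / weight b ≤ 1 := (div_le_one hw.1).2 (hq.2.trans (min_le_left _ _))
  have hq0 : 0 ≤ q / weight b := div_nonneg hq.1 hw.1.le
  have e1 : weight b * ∫ u in (0 : ℝ)..(q / weight b),
      quantile b.2.2.2 ((1 - weight b * u - weight b) / (1 - weight b)) =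
      ∫ s in (0 : ℝ)..q, quantile b.2.2.2 (1 - s / (1 - weight b)) := by
    have := intervalIntegral.integral_comp_div (a := 0) (b := q) (c := weight b)
      (fun u => quantile b.2.2.2 ((1 - weight b * u - weight b) / (1 - weight b))) hw0
    rw [zero_div, smul_eq_mul] at this
    rw [← this]
    have hne : 1 - weight b ≠ 0 := (sub_pos.2 hw.2).ne'
    congr 1
    funext s
    congr 1
    field_simp
    ring
  have e2 : weight b * ∫ u in (0 : ℝ)..(q / weight b), quantile b.2.2.1 u =
      ∫ s in (0 : ℝ)..q, quantile b.2.2.1 (s / weight b) := by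
    rw [intervalIntegral.integral_comp_div _ hw0, zero_div, smul_eq_mul]
  have e3 := intervalIntegral.integral_add_adjacent_intervals
    (intervalIntegrable_sub (intervalIntegrable_quantile hb.1) le_rfl hq0 hqp)
    (intervalIntegrable_sub (intervalIntegrable_quantile hb.1) hq0 hqp le_rfl)
  rw [intervalIntegral_quantile hb.1] at e3
  rw [integral_gap hb.1 hb.2.1 hq, fnJ, mul_add, e1, ← e2, ← e3]
  ring

lemma fnJ'_eq (hb : b ∈ quadruples) {q : ℝ} (hq : q ∈ Icc 0 (cap b)) :
    (1 - weight b) * fnJ' b q = (1 - weight b) * ∫ w, w ∂b.2.2.2 -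
      ∫ s in (0 : ℝ)..q, gap b.2.2.1 b.2.2.2 (weight b) s := by
  have hw := weight_mem hb
  have hpos : 0 < 1 - weight b := sub_pos.2 hw.2
  have hqp : q / (1 - weight b) ≤ 1 := (div_le_one hpos).2 (hq.2.trans (min_le_right _ _))
  have hq0 : 0 ≤ q / (1 - weight b) := div_nonneg hq.1 hpos.le
  have e1 : (1 - weight b) * ∫ u in (0 : ℝ)..(q / (1 - weight b)),
      quantile b.2.2.1 ((1 - weight b) * u / weight b) =
      ∫ s in (0 : ℝ)..q, quantile b.2.2.1 (s / weight b) := by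
    have := intervalIntegral.integral_comp_div (a := 0) (b := q) (c := 1 - weight b)
      (fun u => quantile b.2.2.1 ((1 - weight b) * u / weight b)) hpos.ne'
    rw [zero_div, smul_eq_mul] at this
    rw [← this]
    congr 1
    funext s
    congr 1
    rw [mul_div_cancel₀ _ hpos.ne']
  have e2 : (1 - weight b) * ∫ u in (1 - q / (1 - weight b))..1, quantile b.2.2.2 u =
      ∫ s in (0 : ℝ)..q, quantile b.2.2.2 (1 - s / (1 - weight b)) := by
    rw [intervalIntegral.integral_comp_sub_div _ hpos.ne', zero_div, sub_zero, smul_eq_mul]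
  have e3 := intervalIntegral.integral_add_adjacent_intervals
    (intervalIntegrable_sub (intervalIntegrable_quantile hb.2.1) le_rfl
      (b := 1 - q / (1 - weight b)) (by linarith) (by linarith))
    (intervalIntegrable_sub (intervalIntegrable_quantile hb.2.1) (a := 1 - q / (1 - weight b))
      (by linarith) (by linarith) le_rfl)
  rw [intervalIntegral_quantile hb.2.1] at e3
  have e4 : (1 - q - weight b) / (1 - weight b) = 1 - q / (1 - weight b) := by
    field_simp
    ring
  rw [integral_gap hb.1 hb.2.1 hq, fnJ', mul_add, e1, ← e2, ← e3, e4]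
  ring

/-- Expressed in mass, J(q) = y and J̃(q) = ỹ are the same equation, so the two cases of the
definition merge into one hitting problem on [0, min(p, 1 - p)]. -/
lemma qStar_eq (hb : b ∈ quadruples) : qStar b = sInf {q | q ∈ Icc 0 (cap b) ∧
    ∫ s in (0 : ℝ)..q, gap b.2.2.1 b.2.2.2 (weight b) s = gain b} := by
  have hw := weight_mem hb
  have hpos : 0 < 1 - weight b := sub_pos.2 hw.2
  rw [qStar]
  split_ifs with h
  · have hc : cap b = weight b := min_eq_left (by linarith)
    congr 1
    ext q
    rw [hc]
    refine and_congr_right fun hq => ?_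
    have := fnJ_eq hb (hc ▸ hq)
    rw [← mul_right_inj' hw.1.ne', this, gain]
    constructor <;> intro h <;> linarith
  · have hc : cap b = 1 - weight b := min_eq_right (by linarith)
    congr 1
    ext q
    rw [hc]
    refine and_congr_right fun hq => ?_
    have := fnJ'_eq hb (hc ▸ hq)
    rw [← mul_right_inj' hpos.ne', this, gain_eq hb]
    constructor <;> intro h <;> linarith

lemma qStar_spec (hb : b ∈ quadruples) : qStar b ∈ Icc 0 (cap b) ∧
    ∫ s in (0 : ℝ)..(qStar b), gap b.2.2.1 b.2.2.2 (weight b) s = gain b := by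
  have := (hitting_spec (c := cap b) (cap_pos hb).le (intervalIntegrable_gap hb.1 hb.2.1 (weight_mem hb))
    (gain_pos hb).le (gain_lt hb).le).1
  rw [← qStar_eq hb] at this
  exact this

lemma qStar_le_iff (hb : b ∈ quadruples) {q : ℝ} (hq : q ∈ Icc 0 (cap b)) :
    qStar b ≤ q ↔ gain b ≤ ∫ s in (0 : ℝ)..q, gap b.2.2.1 b.2.2.2 (weight b) s := by
  have := hb.1.1
  have := hb.2.1.1
  rw [qStar_eq hb]
  exact hitting_le_iff (cap_pos hb).le (intervalIntegrable_gap hb.1 hb.2.1 (weight_mem hb))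
    (antitoneOn_gap (weight_mem hb)) (gain_pos hb).le (gain_lt hb) hq

lemma gap_nonneg (hb : b ∈ quadruples) {s : ℝ} (hs : s ∈ Ioo 0 (qStar b)) :
    0 ≤ gap b.2.2.1 b.2.2.2 (weight b) s := by
  have := hb.1.1
  have := hb.2.1.1
  obtain ⟨hq, he⟩ := qStar_spec hb
  exact nonneg_before_hitting (intervalIntegrable_gap hb.1 hb.2.1 (weight_mem hb))
    (antitoneOn_gap (weight_mem hb)) (gain_lt hb) hq he hs

end Exchange

/-! ### The explicit exchange maps -/

/-! ### Images of Lebesgue measure on intervals of mass. -/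

section Levels

lemma smul_map_lam {f : ℝ → ℝ} (hf : Measurable f) {a : ℝ} (ha : 0 < a) :
    ENNReal.ofReal a • lam.map f =
      (volume.restrict (Ioo 0 a)).map fun s => f (s / a) := by
  ext S hS
  have hm : Measurable fun s => f (s / a) := hf.comp (measurable_id.div_const a)
  rw [Measure.smul_apply, Measure.map_apply hf hS, Measure.map_apply hm hS, lam,
    Measure.restrict_apply (hf hS), Measure.restrict_apply (hm hS), smul_eq_mul]
  have : (fun s => f (s / a)) ⁻¹' S ∩ Ioo 0 a = (fun s => a⁻¹ * s) ⁻¹' (f ⁻¹' S ∩ Ioo 0 1) := by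
    ext s
    have : a⁻¹ * s = s / a := by rw [div_eq_inv_mul]
    simp only [mem_inter_iff, mem_preimage, mem_Ioo, this, div_lt_one ha, div_pos_iff_of_pos_right ha]
  rw [this, Real.volume_preimage_mul_left (inv_ne_zero ha.ne'), inv_inv, abs_of_pos ha]

lemma map_ite_restrict_Ioo {g h : ℝ → ℝ} (hg : Measurable g) (hh : Measurable h) {q a : ℝ}
    (hq : 0 ≤ q) (hqa : q ≤ a) :
    (volume.restrict (Ioo 0 a)).map (fun s => if s < q then g s else h s) =
      (volume.restrict (Ioo 0 q)).map g + (volume.restrict (Ioo q a)).map h := by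
  have hm : Measurable fun s => if s < q then g s else h s :=
    Measurable.ite measurableSet_Iio hg hh
  have e : volume.restrict (Ioo 0 a) = volume.restrict (Ioo 0 q) + volume.restrict (Ioo q a) := by
    rw [← Measure.restrict_union (disjoint_left.2 fun x hx hy => lt_asymm hx.2 hy.1)
      measurableSet_Ioo]
    refine Measure.restrict_congr_set ?_
    have : ∀ᵐ x : ℝ, x ≠ q := by simp [ae_iff]
    filter_upwards [this] with x hx
    refine propext ?_
    change x ∈ Ioo 0 a ↔ x ∈ Ioo 0 q ∪ Ioo q a
    simp only [mem_union, mem_Ioo]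
    grind
  rw [e, Measure.map_add _ _ hm]
  congr 1
  · refine Measure.map_congr ?_
    filter_upwards [ae_restrict_mem measurableSet_Ioo] with s hs
    rw [if_pos hs.2]
  · refine Measure.map_congr ?_
    filter_upwards [ae_restrict_mem measurableSet_Ioo] with s hs
    rw [if_neg (not_lt.2 hs.1.le)]

lemma map_restrict_Ioo_add {h : ℝ → ℝ} (hh : Measurable h) {q a : ℝ} (hq : 0 ≤ q) (hqa : q ≤ a) :
    (volume.restrict (Ioo 0 q)).map h + (volume.restrict (Ioo q a)).map h =
      (volume.restrict (Ioo 0 a)).map h := by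
  rw [← map_ite_restrict_Ioo hh hh hq hqa]
  simp

/-- Needed because the top of η̃ is counted from above in `gap` but enumerated from below in
`exchangeSnd`. -/
lemma map_reflect {h : ℝ → ℝ} (hh : Measurable h) (t a b : ℝ) :
    (volume.restrict (Ioo a b)).map (fun s => h (t - s)) =
      (volume.restrict (Ioo (t - b) (t - a))).map h := by
  have hmp := (Measure.measurePreserving_sub_left (volume : Measure ℝ) t).restrict_preimage
    (measurableSet_Ioo (a := t - b) (b := t - a))
  have hpre : (fun s => t - s) ⁻¹' Ioo (t - b) (t - a) = Ioo a b := by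
    ext s; simp only [mem_preimage, mem_Ioo]; constructor <;> rintro ⟨_, _⟩ <;> constructor <;> linarith
  rw [hpre] at hmp
  rw [← hmp.map_eq, Measure.map_map hh hmp.measurable]
  rfl

lemma measurable_map_lam {X : Type*} [MeasurableSpace X] {F : X × ℝ → ℝ} (hF : Measurable F) :
    Measurable fun b => lam.map fun u => F (b, u) := by
  refine Measure.measurable_measure.2 fun S hS => ?_
  have : (fun b => lam.map (fun u => F (b, u)) S) = fun b => lam (Prod.mk b ⁻¹' (F ⁻¹' S)) := by
    funext b
    rw [Measure.map_apply (by fun_prop) hS]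
    rfl
  rw [this]
  exact measurable_measure_prodMk_left (hF hS)

end Levels

/-! ### The exchanged laws: mixture, means and stochastic order. -/

section Laws

variable {b : ℝ × ℝ × Measure ℝ × Measure ℝ}

lemma measurable_exchangeFst_fun (hb : b ∈ quadruples) : Measurable fun u =>
    if u < qStar b / weight b then
      quantile b.2.2.2 ((1 - weight b * u - weight b) / (1 - weight b))
    else quantile b.2.2.1 u := by
  have := hb.1.1
  have := hb.2.1.1
  exact Measurable.ite measurableSet_Iio ((measurable_quantile _).comp (by fun_prop))
    (measurable_quantile _)

lemma measurable_exchangeSnd_fun (hb : b ∈ quadruples) : Measurable fun u =>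
    if u < qStar b / (1 - weight b) then quantile b.2.2.1 ((1 - weight b) * u / weight b)
    else quantile b.2.2.2 (u - qStar b / (1 - weight b)) := by
  have := hb.1.1
  have := hb.2.1.1
  exact Measurable.ite measurableSet_Iio ((measurable_quantile _).comp (by fun_prop))
    ((measurable_quantile _).comp (by fun_prop))

lemma measurable_lower_div (hb : b ∈ quadruples) (a : ℝ) :
    Measurable fun s => quantile b.2.2.1 (s / a) := by
  have := hb.1.1
  exact (measurable_quantile _).comp (measurable_id.div_const a)

lemma measurable_upper_sub_div (hb : b ∈ quadruples) (a : ℝ) :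
    Measurable fun s => quantile b.2.2.2 (1 - s / a) := by
  have := hb.2.1.1
  exact (measurable_quantile _).comp (measurable_const.sub (measurable_id.div_const a))

lemma isProbabilityMeasure_exchangeFst (hb : b ∈ quadruples) :
    IsProbabilityMeasure (exchangeFst b) :=
  Measure.isProbabilityMeasure_map (measurable_exchangeFst_fun hb).aemeasurable

lemma isProbabilityMeasure_exchangeSnd (hb : b ∈ quadruples) :
    IsProbabilityMeasure (exchangeSnd b) :=
  Measure.isProbabilityMeasure_map (measurable_exchangeSnd_fun hb).aemeasurable

lemma smul_exchangeFst (hb : b ∈ quadruples) :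
    ENNReal.ofReal (weight b) • exchangeFst b =
      (volume.restrict (Ioo 0 (qStar b))).map
        (fun s => quantile b.2.2.2 (1 - s / (1 - weight b))) +
      (volume.restrict (Ioo (qStar b) (weight b))).map
        (fun s => quantile b.2.2.1 (s / weight b)) := by
  have := hb.1.1
  have := hb.2.1.1
  have hw := weight_mem hb
  have hpos : 0 < 1 - weight b := sub_pos.2 hw.2
  obtain ⟨hq, -⟩ := qStar_spec hb
  rw [exchangeFst, smul_map_lam (measurable_exchangeFst_fun hb) hw.1,
    ← map_ite_restrict_Ioo (measurable_upper_sub_div hb _) (measurable_lower_div hb _) hq.1 (hq.2.trans (min_le_left _ _))]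
  congr 1
  funext s
  have e : (1 - weight b * (s / weight b) - weight b) / (1 - weight b) =
      1 - s / (1 - weight b) := by
    rw [mul_div_cancel₀ _ hw.1.ne']
    field_simp
    ring
  rw [e]
  simp only [div_lt_div_iff_of_pos_right hw.1]

lemma smul_exchangeSnd (hb : b ∈ quadruples) :
    ENNReal.ofReal (1 - weight b) • exchangeSnd b =
      (volume.restrict (Ioo 0 (qStar b))).map (fun s => quantile b.2.2.1 (s / weight b)) +
      (volume.restrict (Ioo (qStar b) (1 - weight b))).map
        (fun s => quantile b.2.2.2 (1 - s / (1 - weight b))) := by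
  have := hb.1.1
  have := hb.2.1.1
  have hw := weight_mem hb
  have hpos : 0 < 1 - weight b := sub_pos.2 hw.2
  obtain ⟨hq, -⟩ := qStar_spec hb
  have hm := measurable_upper_sub_div hb (1 - weight b)
  -- The reflection about the midpoint of (q⋆, 1 - p) turns the decreasing enumeration of what is
  -- left of η̃ into the increasing one.
  have er := map_reflect hm (1 - weight b + qStar b) (qStar b) (1 - weight b)
  rw [add_sub_cancel_left, add_sub_cancel_right] at er
  rw [← er, exchangeSnd, smul_map_lam (measurable_exchangeSnd_fun hb) hpos,
    ← map_ite_restrict_Ioo (measurable_lower_div hb _)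
      (h := fun s => quantile b.2.2.2 (1 - (1 - weight b + qStar b - s) / (1 - weight b)))
      (hm.comp (measurable_const.sub measurable_id)) hq.1 (hq.2.trans (min_le_right _ _))]
  congr 1
  funext s
  have e : s / (1 - weight b) - qStar b / (1 - weight b) =
      1 - (1 - weight b + qStar b - s) / (1 - weight b) := by
    field_simp
    ring
  rw [e, mul_div_cancel₀ _ hpos.ne']
  simp only [div_lt_div_iff_of_pos_right hpos]

/-- Cutting p η and (1 - p) η̃ at mass q⋆ gives four pieces; the two exchanged laws contain the same
four pieces, regrouped. -/
lemma exchange_mixture (hb : b ∈ quadruples) :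
    ENNReal.ofReal (weight b) • exchangeFst b + ENNReal.ofReal (1 - weight b) • exchangeSnd b =
      ENNReal.ofReal (weight b) • b.2.2.1 + ENNReal.ofReal (1 - weight b) • b.2.2.2 := by
  have := hb.1.1
  have := hb.2.1.1
  have hw := weight_mem hb
  have hpos : 0 < 1 - weight b := sub_pos.2 hw.2
  obtain ⟨hq, -⟩ := qStar_spec hb
  have hm := measurable_upper_sub_div hb (1 - weight b)
  have hm1 := measurable_lower_div hb (weight b)
  have e1 : ENNReal.ofReal (weight b) • b.2.2.1 = (volume.restrict (Ioo 0 (weight b))).map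
      fun s => quantile b.2.2.1 (s / weight b) := by
    rw [← smul_map_lam (measurable_quantile _) hw.1, map_quantile]
  have e2 : ENNReal.ofReal (1 - weight b) • b.2.2.2 =
      (volume.restrict (Ioo 0 (1 - weight b))).map
        fun s => quantile b.2.2.2 (1 - s / (1 - weight b)) := by
    have er := map_reflect hm (1 - weight b) 0 (1 - weight b)
    rw [sub_self, sub_zero] at er
    rw [← er]
    conv_lhs => rw [← map_quantile b.2.2.2, smul_map_lam (measurable_quantile _) hpos]
    congr 1
    funext s
    congr 1
    field_simp
    ring
  rw [e1, e2, smul_exchangeFst hb, smul_exchangeSnd hb,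
    ← map_restrict_Ioo_add hm1 hq.1 (hq.2.trans (min_le_left _ _)),
    ← map_restrict_Ioo_add hm hq.1 (hq.2.trans (min_le_right _ _))]
  abel

variable {β β' : Measure ℝ}

lemma ofReal_weight_ne (hb : b ∈ quadruples) :
    ENNReal.ofReal (weight b) ≠ 0 ∧ ENNReal.ofReal (1 - weight b) ≠ 0 := by
  have hw := weight_mem hb
  constructor <;> simp only [ne_eq, ENNReal.ofReal_eq_zero, not_le] <;> linarith [hw.1, hw.2]

lemma integrable_of_mixture (hb : b ∈ quadruples)
    (hmix : ENNReal.ofReal (weight b) • β + ENNReal.ofReal (1 - weight b) • β' =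
      ENNReal.ofReal (weight b) • b.2.2.1 + ENNReal.ofReal (1 - weight b) • b.2.2.2) :
    Integrable (fun w : ℝ => w) β ∧ Integrable (fun w : ℝ => w) β' := by
  have hi : Integrable (fun w : ℝ => w)
      (ENNReal.ofReal (weight b) • β + ENNReal.ofReal (1 - weight b) • β') := by
    rw [hmix]
    exact (hb.1.2.smul_measure ENNReal.ofReal_ne_top).add_measure
      (hb.2.1.2.smul_measure ENNReal.ofReal_ne_top)
  obtain ⟨h1, h2⟩ := ofReal_weight_ne hb
  rw [integrable_add_measure, integrable_smul_measure h1 ENNReal.ofReal_ne_top,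
    integrable_smul_measure h2 ENNReal.ofReal_ne_top] at hi
  exact hi

/-- What η gains, η̃ loses: the weight is chosen so that p (y - x) = (1 - p) (x̃ - ỹ), which is
`gain_eq`. -/
lemma mean_of_mixture (hb : b ∈ quadruples)
    (hmix : ENNReal.ofReal (weight b) • β + ENNReal.ofReal (1 - weight b) • β' =
      ENNReal.ofReal (weight b) • b.2.2.1 + ENNReal.ofReal (1 - weight b) • b.2.2.2)
    (hmean : ∫ w, w ∂β = b.1) : ∫ w, w ∂β' = b.2.1 := by
  have hw := weight_mem hb
  have hpos : 0 < 1 - weight b := sub_pos.2 hw.2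
  obtain ⟨h1, h2⟩ := integrable_of_mixture hb hmix
  have := congrArg (fun ρ : Measure ℝ => ∫ w, w ∂ρ) hmix
  rw [integral_add_measure (h1.smul_measure ENNReal.ofReal_ne_top)
      (h2.smul_measure ENNReal.ofReal_ne_top),
    integral_add_measure (hb.1.2.smul_measure ENNReal.ofReal_ne_top)
      (hb.2.1.2.smul_measure ENNReal.ofReal_ne_top)] at this
  simp only [integral_smul_measure, ENNReal.toReal_ofReal hw.1.le, ENNReal.toReal_ofReal hpos.le,
    smul_eq_mul, hmean] at this
  have hg := gain_eq hb
  rw [gain] at hg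
  refine mul_left_cancel₀ hpos.ne' ?_
  linarith

/-- With the mixture conserved, mass that the first law loses on a lower half-line is gained there
by the second. -/
lemma stochLE_of_mixture [IsProbabilityMeasure β] [IsProbabilityMeasure β'] (hb : b ∈ quadruples)
    (hmix : ENNReal.ofReal (weight b) • β + ENNReal.ofReal (1 - weight b) • β' =
      ENNReal.ofReal (weight b) • b.2.2.1 + ENNReal.ofReal (1 - weight b) • b.2.2.2)
    (hle : ∀ x, β (Iic x) ≤ b.2.2.1 (Iic x)) : StochLE β' b.2.2.2 := by
  have := hb.1.1
  have := hb.2.1.1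
  refine stochLE_of_measure_le fun x => ?_
  have h := congrArg (fun ρ : Measure ℝ => ρ (Iic x)) hmix
  simp only [Measure.add_apply, Measure.smul_apply, smul_eq_mul] at h
  rw [← ENNReal.mul_le_mul_iff_right (ofReal_weight_ne hb).2 ENNReal.ofReal_ne_top]
  have h1 : ENNReal.ofReal (weight b) * β (Iic x) ≤ ENNReal.ofReal (weight b) * b.2.2.1 (Iic x) :=
    mul_le_mul_right (hle x) _
  have hfin : ENNReal.ofReal (weight b) * β (Iic x) ≠ ⊤ :=
    ENNReal.mul_ne_top ENNReal.ofReal_ne_top (measure_ne_top _ _)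
  rw [← ENNReal.add_le_add_iff_left hfin, h]
  gcongr

lemma integral_id_map_restrict_Ioo {h : ℝ → ℝ} (hh : Measurable h) {a c : ℝ} (hac : a ≤ c) :
    ∫ w, w ∂((volume.restrict (Ioo a c)).map h) = ∫ s in a..c, h s := by
  rw [integral_id_map hh.aemeasurable, intervalIntegral.integral_of_le hac,
    integral_Ioc_eq_integral_Ioo]

lemma exchangeFst_mean (hb : b ∈ quadruples) : ∫ w, w ∂(exchangeFst b) = b.1 := by
  have := hb.1.1
  have := hb.2.1.1
  have hw := weight_mem hb
  have hpos : 0 < 1 - weight b := sub_pos.2 hw.2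
  obtain ⟨hq, he⟩ := qStar_spec hb
  have hqw := hq.2.trans (min_le_left _ _)
  have hm := measurable_upper_sub_div hb (1 - weight b)
  have hm1 := measurable_lower_div hb (weight b)
  have hi := (integrable_of_mixture hb (exchange_mixture hb)).1.smul_measure
    (c := ENNReal.ofReal (weight b)) ENNReal.ofReal_ne_top
  have hs := congrArg (fun ρ : Measure ℝ => ∫ w, w ∂ρ) (smul_exchangeFst hb)
  rw [smul_exchangeFst hb, integrable_add_measure] at hi
  rw [integral_add_measure hi.1 hi.2, integral_id_map_restrict_Ioo hm hq.1,
    integral_id_map_restrict_Ioo hm1 hqw, integral_smul_measure,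
    ENNReal.toReal_ofReal hw.1.le, smul_eq_mul] at hs
  have hii := intervalIntegrable_quantile_div hb.1 (weight b)
  have e3 := intervalIntegral.integral_add_adjacent_intervals
    (intervalIntegrable_sub hii le_rfl hq.1 hqw) (intervalIntegrable_sub hii hq.1 hqw le_rfl)
  rw [intervalIntegral.integral_comp_div (a := 0) (b := weight b) _ hw.1.ne', zero_div,
    div_self hw.1.ne', intervalIntegral_quantile hb.1, smul_eq_mul] at e3
  rw [integral_gap hb.1 hb.2.1 hq, gain] at he
  refine mul_left_cancel₀ hw.1.ne' ?_
  linarith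

/-- The comparison is made level by level: below q⋆/p the quantile of η is replaced by a value that
is no smaller, by `gap_nonneg`, and elsewhere it is kept. The resulting function of the level need
not be monotone. -/
lemma exchangeFst_Iic_le (hb : b ∈ quadruples) (x : ℝ) :
    exchangeFst b (Iic x) ≤ b.2.2.1 (Iic x) := by
  have := hb.1.1
  have hw := weight_mem hb
  have hpos : 0 < 1 - weight b := sub_pos.2 hw.2
  conv_rhs => rw [← map_quantile b.2.2.1]
  rw [exchangeFst, Measure.map_apply (measurable_exchangeFst_fun hb) measurableSet_Iic,
    Measure.map_apply (measurable_quantile _) measurableSet_Iic]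
  refine measure_mono_ae ?_
  filter_upwards [ae_lam_mem] with u hu h
  change quantile b.2.2.1 u ≤ x
  change (if u < qStar b / weight b then _ else _) ≤ x at h
  split_ifs at h with hlt
  · refine le_trans ?_ h
    have hg := gap_nonneg hb (s := weight b * u)
      ⟨mul_pos hw.1 hu.1, by rwa [lt_div_iff₀' hw.1] at hlt⟩
    rw [gap, mul_div_cancel_left₀ _ hw.1.ne'] at hg
    have e : (1 - weight b * u - weight b) / (1 - weight b) = 1 - weight b * u / (1 - weight b) := by
      field_simp
      ring
    rw [e]
    linarith
  · exact h

end Laws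

/-! ### Measurability of the explicit exchange maps -/

/-- The third component of a quadruple, as a kernel. -/
noncomputable def lowerKernel : Kernel quadruples ℝ :=
  ⟨fun b => b.1.2.2.1, by fun_prop⟩

/-- The fourth component of a quadruple, as a kernel. -/
noncomputable def upperKernel : Kernel quadruples ℝ :=
  ⟨fun b => b.1.2.2.2, by fun_prop⟩

instance : IsMarkovKernel lowerKernel := ⟨fun b => b.2.1.1⟩

instance : IsMarkovKernel upperKernel := ⟨fun b => b.2.2.1.1⟩

lemma measurable_mean_lower : Measurable fun b : quadruples => ∫ w, w ∂b.1.2.2.1 :=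
  (StronglyMeasurable.integral_kernel (κ := lowerKernel) stronglyMeasurable_id).measurable

lemma measurable_mean_upper : Measurable fun b : quadruples => ∫ w, w ∂b.1.2.2.2 :=
  (StronglyMeasurable.integral_kernel (κ := upperKernel) stronglyMeasurable_id).measurable

lemma measurable_weight : Measurable fun b : quadruples => weight b := by
  have := measurable_mean_lower
  have := measurable_mean_upper
  unfold weight
  fun_prop

lemma measurable_gain : Measurable fun b : quadruples => gain b := by
  have := measurable_mean_lower
  have := measurable_weight
  unfold gain
  fun_prop

lemma measurable_cap : Measurable fun b : quadruples => cap b :=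
  measurable_weight.min (measurable_const.sub measurable_weight)

lemma measurable_lower_quantile {Y : Type*} [MeasurableSpace Y] {f : Y → quadruples} {g : Y → ℝ}
    (hf : Measurable f) (hg : Measurable g) : Measurable fun z => quantile (f z).1.2.2.1 (g z) :=
  (measurable_quantile_kernel lowerKernel).comp (hf.prodMk hg)

lemma measurable_upper_quantile {Y : Type*} [MeasurableSpace Y] {f : Y → quadruples} {g : Y → ℝ}
    (hf : Measurable f) (hg : Measurable g) : Measurable fun z => quantile (f z).1.2.2.2 (g z) :=
  (measurable_quantile_kernel upperKernel).comp (hf.prodMk hg)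

lemma measurable_integral_gap {q : quadruples → ℝ} (hq : Measurable q) (hq0 : ∀ b, 0 ≤ q b) :
    Measurable fun b : quadruples =>
      ∫ s in (0 : ℝ)..(q b), gap b.1.2.2.1 b.1.2.2.2 (weight b) s := by
  have hw : Measurable fun z : quadruples × ℝ => weight z.1 := measurable_weight.comp measurable_fst
  have hg : Measurable fun z : quadruples × ℝ => gap z.1.1.2.2.1 z.1.1.2.2.2 (weight z.1) z.2 :=
    (measurable_upper_quantile measurable_fst (by fun_prop)).sub
      (measurable_lower_quantile measurable_fst (by fun_prop))
  have hset : MeasurableSet {z : quadruples × ℝ | z.2 ∈ Ioc 0 (q z.1)} :=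
    (measurableSet_lt measurable_const measurable_snd).inter
      (measurableSet_le measurable_snd (hq.comp measurable_fst))
  have h := ((hg.indicator hset).stronglyMeasurable.integral_prod_right' (ν := volume)).measurable
  convert h using 2 with b
  rw [intervalIntegral.integral_of_le (hq0 b), ← integral_indicator measurableSet_Ioc]
  rfl

lemma measurable_qStar : Measurable fun b : quadruples => qStar b := by
  refine measurable_of_Iic fun t => ?_
  by_cases ht : 0 ≤ t
  · have hmem : ∀ b : quadruples, min t (cap b) ∈ Icc 0 (cap b) := fun b =>
      ⟨le_min ht (cap_pos b.2).le, min_le_right _ _⟩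
    have : (fun b : quadruples => qStar b) ⁻¹' Iic t = {b : quadruples | gain b ≤
        ∫ s in (0 : ℝ)..(min t (cap b)), gap b.1.2.2.1 b.1.2.2.2 (weight b) s} := by
      ext b
      change qStar b ≤ t ↔ gain b ≤ _
      rw [← qStar_le_iff b.2 (hmem b), le_min_iff]
      exact ⟨fun h => ⟨h, (qStar_spec b.2).1.2⟩, fun h => h.1⟩
    rw [this]
    exact measurableSet_le measurable_gain
      (measurable_integral_gap (measurable_const.min measurable_cap) fun b => (hmem b).1)
  · have : (fun b : quadruples => qStar b) ⁻¹' Iic t = ∅ :=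
      eq_empty_of_forall_notMem fun b hb => ht ((qStar_spec b.2).1.1.trans hb)
    rw [this]
    exact MeasurableSet.empty

lemma measurable_exchangeFst : Measurable fun b : quadruples => exchangeFst b := by
  have hw : Measurable fun z : quadruples × ℝ => weight z.1 := measurable_weight.comp measurable_fst
  have hq : Measurable fun z : quadruples × ℝ => qStar z.1 := measurable_qStar.comp measurable_fst
  exact measurable_map_lam (F := fun z : quadruples × ℝ => if z.2 < qStar z.1 / weight z.1 then
      quantile z.1.1.2.2.2 ((1 - weight z.1 * z.2 - weight z.1) / (1 - weight z.1))
    else quantile z.1.1.2.2.1 z.2)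
    (Measurable.ite (measurableSet_lt measurable_snd (by fun_prop))
      (measurable_upper_quantile measurable_fst (by fun_prop))
      (measurable_lower_quantile measurable_fst measurable_snd))

lemma measurable_exchangeSnd : Measurable fun b : quadruples => exchangeSnd b := by
  have hw : Measurable fun z : quadruples × ℝ => weight z.1 := measurable_weight.comp measurable_fst
  have hq : Measurable fun z : quadruples × ℝ => qStar z.1 := measurable_qStar.comp measurable_fst
  exact measurable_map_lam (F := fun z : quadruples × ℝ => if z.2 < qStar z.1 / (1 - weight z.1) then
      quantile z.1.1.2.2.1 ((1 - weight z.1) * z.2 / weight z.1)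
    else quantile z.1.1.2.2.2 (z.2 - qStar z.1 / (1 - weight z.1)))
    (Measurable.ite (measurableSet_lt measurable_snd (by fun_prop))
      (measurable_lower_quantile measurable_fst (by fun_prop))
      (measurable_upper_quantile measurable_fst (by fun_prop)))

theorem isExchange_exchangeFst_exchangeSnd : IsExchange exchangeFst exchangeSnd where
  measurable_fst := measurable_exchangeFst
  measurable_snd := measurable_exchangeSnd
  isP1_fst _ hb := ⟨isProbabilityMeasure_exchangeFst hb,
    (integrable_of_mixture hb (exchange_mixture hb)).1⟩
  isP1_snd _ hb := ⟨isProbabilityMeasure_exchangeSnd hb,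
    (integrable_of_mixture hb (exchange_mixture hb)).2⟩
  mean_fst _ hb := exchangeFst_mean hb
  mean_snd _ hb := mean_of_mixture hb (exchange_mixture hb) (exchangeFst_mean hb)
  stochLE_fst _ hb := by
    have := isProbabilityMeasure_exchangeFst hb
    have := hb.1.1
    exact stochLE_of_measure_le (exchangeFst_Iic_le hb)
  stochLE_snd _ hb := by
    have := isProbabilityMeasure_exchangeFst hb
    have := isProbabilityMeasure_exchangeSnd hb
    exact stochLE_of_mixture hb (exchange_mixture hb) (exchangeFst_Iic_le hb)
  mixture _ hb := exchange_mixture hb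

/-! ### Transport between densities on the unit interval -/

/-- The measure with density `d` on the unit interval. -/
noncomputable def densityMeasure (d : ℝ → ℝ) : Measure ℝ :=
  lam.withDensity fun u => ENNReal.ofReal (d u)

/-- The distribution function of the density `d`. -/
noncomputable def distFun (d : ℝ → ℝ) (u : ℝ) : ℝ := ∫ v in (0 : ℝ)..u, d v

section Transport

variable {d e : ℝ → ℝ}

lemma measurable_distFun (hd : Measurable d) : Measurable (distFun d) := by
  have h1 : MeasurableSet {z : ℝ × ℝ | z.2 ∈ Ioc 0 z.1} :=
    (measurableSet_lt measurable_const measurable_snd).inter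
      (measurableSet_le measurable_snd measurable_fst)
  have h2 : MeasurableSet {z : ℝ × ℝ | z.2 ∈ Ioc z.1 0} :=
    (measurableSet_lt measurable_fst measurable_snd).inter
      (measurableSet_le measurable_snd measurable_const)
  have hs : Measurable fun z : ℝ × ℝ => d z.2 := hd.comp measurable_snd
  have h := ((hs.indicator h1).stronglyMeasurable.integral_prod_right' (ν := volume)).measurable.sub
    ((hs.indicator h2).stronglyMeasurable.integral_prod_right' (ν := volume)).measurable
  convert h using 1
  funext u
  rw [distFun, intervalIntegral, ← integral_indicator measurableSet_Ioc,
    ← integral_indicator measurableSet_Ioc]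
  rfl

@[simp] lemma distFun_zero : distFun d 0 = 0 := intervalIntegral.integral_same

lemma exists_distFun_eq (hdi : IntervalIntegrable d volume 0 1) {t : ℝ} (ht : t ∈ Icc 0 (distFun d 1)) :
    ∃ r ∈ Icc (0 : ℝ) 1, distFun d r = t :=
  intermediate_value_Icc (f := distFun d) zero_le_one (continuousOn_primitive zero_le_one hdi)
    (by simpa using ht)

lemma ae_densityMeasure_mem : ∀ᵐ u ∂densityMeasure d, u ∈ Ioo (0 : ℝ) 1 :=
  (withDensity_absolutelyContinuous _ _).ae_le ae_lam_mem

lemma genInv_spec (hdi : IntervalIntegrable d volume 0 1) {v : ℝ} (hv : v ≤ distFun d 1) :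
    IsLeast {r | r ∈ Icc (0 : ℝ) 1 ∧ v ≤ distFun d r} (genInv (distFun d) v) := by
  have hcl : IsClosed {r | r ∈ Icc (0 : ℝ) 1 ∧ v ≤ distFun d r} :=
    (continuousOn_primitive zero_le_one hdi).preimage_isClosed_of_isClosed isClosed_Icc isClosed_Ici
  have hbdd : BddBelow {r | r ∈ Icc (0 : ℝ) 1 ∧ v ≤ distFun d r} := ⟨0, fun q hq => hq.1.1⟩
  exact ⟨hcl.csInf_mem ⟨1, ⟨zero_le_one, le_rfl⟩, hv⟩ hbdd, fun q hq => csInf_le hbdd hq⟩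

lemma genInv_mem (D : ℝ → ℝ) (v : ℝ) : genInv D v ∈ Icc (0 : ℝ) 1 := by
  rcases eq_empty_or_nonempty {r | r ∈ Icc (0 : ℝ) 1 ∧ v ≤ D r} with h | h
  · rw [genInv, h, Real.sInf_empty]; exact ⟨le_rfl, zero_le_one⟩
  · have hbdd : BddBelow {r | r ∈ Icc (0 : ℝ) 1 ∧ v ≤ D r} := ⟨0, fun q hq => hq.1.1⟩
    obtain ⟨r, hr⟩ := id h
    exact ⟨le_csInf h fun q hq => hq.1.1, (csInf_le hbdd hr).trans hr.1.2⟩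

lemma ae_densityMeasure_iff {d : ℝ → ℝ} (hd : Measurable d) {P : ℝ → Prop} :
    (∀ᵐ u ∂densityMeasure d, P u) ↔ ∀ᵐ u ∂lam, 0 < d u → P u := by
  rw [densityMeasure, ae_withDensity_iff hd.ennreal_ofReal]
  simp only [ne_eq, ENNReal.ofReal_eq_zero, not_le]

variable (hd0 : ∀ u, 0 ≤ d u) (hdi : IntervalIntegrable d volume 0 1)
include hd0 hdi

lemma distFun_mono : MonotoneOn (distFun d) (Icc 0 1) := by
  intro a ha b hb hab
  have := intervalIntegral.integral_nonneg (μ := volume) hab fun u _ => hd0 u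
  rw [distFun, distFun, ← intervalIntegral.integral_add_adjacent_intervals
    (intervalIntegrable_sub hdi le_rfl ha.1 ha.2) (intervalIntegrable_sub hdi ha.1 hab hb.2)]
  linarith

lemma distFun_nonneg {u : ℝ} (hu : u ∈ Icc (0 : ℝ) 1) : 0 ≤ distFun d u := by
  have := distFun_mono hd0 hdi ⟨le_rfl, zero_le_one⟩ hu hu.1
  rwa [distFun_zero] at this

lemma densityMeasure_Iic {r : ℝ} (hr : r ∈ Icc (0 : ℝ) 1) :
    densityMeasure d (Iic r) = ENNReal.ofReal (distFun d r) := by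
  rw [densityMeasure, withDensity_apply _ measurableSet_Iic, lam,
    Measure.restrict_restrict measurableSet_Iic, distFun, intervalIntegral.integral_of_le hr.1,
    integral_Ioc_eq_integral_Ioo]
  have e : (Iic r ∩ Ioo 0 1 : Set ℝ) =ᵐ[volume] Ioo 0 r := by
    have : ∀ᵐ x : ℝ, x ≠ r := by simp [ae_iff]
    filter_upwards [this] with x hx
    refine propext ?_
    change x ∈ Iic r ∩ Ioo 0 1 ↔ x ∈ Ioo 0 r
    have := hr.2
    simp only [mem_inter_iff, mem_Iic, mem_Ioo]
    grind
  rw [Measure.restrict_congr_set e, ← ofReal_integral_eq_lintegral_ofReal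
    ((intervalIntegrable_iff_integrableOn_Ioo_of_le hr.1).1
      (intervalIntegrable_sub hdi le_rfl hr.1 hr.2)) (.of_forall hd0)]

lemma densityMeasure_univ : densityMeasure d univ = ENNReal.ofReal (distFun d 1) := by
  rw [← densityMeasure_Iic hd0 hdi ⟨zero_le_one, le_rfl⟩]
  refine measure_congr ?_
  filter_upwards [ae_densityMeasure_mem] with u hu
  exact propext ⟨fun _ => hu.2.le, fun _ => trivial⟩

lemma isFiniteMeasure_densityMeasure : IsFiniteMeasure (densityMeasure d) :=
  ⟨by rw [densityMeasure_univ hd0 hdi]; exact ENNReal.ofReal_lt_top⟩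

/-- The distribution function is uniformly distributed. -/
lemma densityMeasure_distFun_le {t : ℝ} (ht : t ∈ Icc 0 (distFun d 1)) :
    densityMeasure d {u | distFun d u ≤ t} = ENNReal.ofReal t := by
  have hcl : IsCompact (Icc (0 : ℝ) 1 ∩ distFun d ⁻¹' Iic t) :=
    isCompact_Icc.of_isClosed_subset
      ((continuousOn_primitive zero_le_one hdi).preimage_isClosed_of_isClosed isClosed_Icc
        isClosed_Iic) inter_subset_left
  have hne : (Icc (0 : ℝ) 1 ∩ distFun d ⁻¹' Iic t).Nonempty :=
    ⟨0, ⟨le_rfl, zero_le_one⟩, by simpa using ht.1⟩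
  -- `r` is the right end of the plateau at height `t`, so the sublevel set is the initial interval
  -- up to `r`.
  obtain ⟨r, ⟨hr, hrt⟩, hmax⟩ := hcl.exists_isGreatest hne
  obtain ⟨r', hr', he⟩ := exists_distFun_eq hdi ht
  have hre : distFun d r = t :=
    le_antisymm hrt (he ▸ distFun_mono hd0 hdi hr' hr (hmax ⟨hr', he.le⟩))
  rw [← hre, ← densityMeasure_Iic hd0 hdi hr, hre]
  refine measure_congr ?_
  filter_upwards [ae_densityMeasure_mem] with u hu
  have hu' : u ∈ Icc (0 : ℝ) 1 := Ioo_subset_Icc_self hu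
  exact propext ⟨fun h => hmax ⟨hu', h⟩, fun h => (distFun_mono hd0 hdi hu' hr h).trans hrt⟩

lemma genInv_le_iff {v r : ℝ} (hv : v ≤ distFun d 1) (hr : r ∈ Icc (0 : ℝ) 1) :
    genInv (distFun d) v ≤ r ↔ v ≤ distFun d r := by
  obtain ⟨⟨hm, hle⟩, hleast⟩ := genInv_spec hdi hv
  exact ⟨fun h => hle.trans (distFun_mono hd0 hdi hm hr h), fun h => hleast ⟨hr, h⟩⟩

lemma distFun_genInv {v : ℝ} (hv : v ∈ Icc 0 (distFun d 1)) :
    distFun d (genInv (distFun d) v) = v := by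
  obtain ⟨⟨hm, hle⟩, hleast⟩ := genInv_spec hdi hv.2
  obtain ⟨r, hr, he⟩ := exists_distFun_eq hdi hv
  exact le_antisymm (he ▸ distFun_mono hd0 hdi hm hr (hleast ⟨hr, he.ge⟩)) hle

lemma measurable_genInv : Measurable (genInv (distFun d)) := by
  refine measurable_of_Iic fun r => ?_
  by_cases h0 : r < 0
  · have : genInv (distFun d) ⁻¹' Iic r = ∅ := eq_empty_of_forall_notMem fun v hv =>
      absurd ((genInv_mem _ v).1.trans hv) (not_le.2 h0)
    rw [this]; exact MeasurableSet.empty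
  by_cases h1 : 1 ≤ r
  · have : genInv (distFun d) ⁻¹' Iic r = univ :=
      eq_univ_of_forall fun v => (genInv_mem _ v).2.trans h1
    rw [this]; exact MeasurableSet.univ
  push Not at h0 h1
  -- Above the total mass the defining set is empty and `genInv` is 0 by default, so all of these
  -- arguments join the sublevel set.
  have : genInv (distFun d) ⁻¹' Iic r = Iic (distFun d r) ∪ Ioi (distFun d 1) := by
    ext v
    by_cases hv : v ≤ distFun d 1
    · have := genInv_le_iff hd0 hdi hv ⟨h0, h1.le⟩
      simp [this, hv]
    · have he : {r | r ∈ Icc (0 : ℝ) 1 ∧ v ≤ distFun d r} = ∅ :=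
        eq_empty_of_forall_notMem fun q hq =>
          hv (hq.2.trans (distFun_mono hd0 hdi hq.1 ⟨zero_le_one, le_rfl⟩ hq.1.2))
      have hz : genInv (distFun d) v = 0 := by rw [genInv, he, Real.sInf_empty]
      simp [hz, h0, not_le.1 hv]
  rw [this]
  exact measurableSet_Iic.union measurableSet_Ioi

/-- Quantile transport: `distFun d` makes the measure uniform on [0, mass], and the generalized
inverse of `distFun e` carries this uniform law to the density `e`. -/
lemma map_genInv_distFun (hd : Measurable d) (he0 : ∀ u, 0 ≤ e u)
    (hei : IntervalIntegrable e volume 0 1) (hmass : distFun d 1 = distFun e 1) :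
    (densityMeasure d).map (fun u => genInv (distFun e) (distFun d u)) = densityMeasure e := by
  have := isFiniteMeasure_densityMeasure hd0 hdi
  have := isFiniteMeasure_densityMeasure he0 hei
  have hm : Measurable fun u => genInv (distFun e) (distFun d u) :=
    (measurable_genInv he0 hei).comp (measurable_distFun hd)
  refine Measure.ext_of_Iic _ _ fun r => ?_
  rw [Measure.map_apply hm measurableSet_Iic]
  by_cases h0 : r < 0
  · have e1 : (fun u => genInv (distFun e) (distFun d u)) ⁻¹' Iic r = ∅ :=
      eq_empty_of_forall_notMem fun v hv => absurd ((genInv_mem _ _).1.trans hv) (not_le.2 h0)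
    rw [e1, measure_empty]
    refine (measure_eq_zero_iff_ae_notMem.2 ?_).symm
    filter_upwards [ae_densityMeasure_mem] with u hu h
    exact absurd (hu.1.le.trans h) (not_le.2 h0)
  by_cases h1 : 1 ≤ r
  · have e1 : (fun u => genInv (distFun e) (distFun d u)) ⁻¹' Iic r = univ :=
      eq_univ_of_forall fun v => (genInv_mem _ _).2.trans h1
    rw [e1, densityMeasure_univ hd0 hdi, hmass, ← densityMeasure_univ he0 hei]
    refine measure_congr ?_
    filter_upwards [ae_densityMeasure_mem] with u hu
    exact propext ⟨fun _ => hu.2.le.trans h1, fun _ => trivial⟩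
  push Not at h0 h1
  have hr : r ∈ Icc (0 : ℝ) 1 := ⟨h0, h1.le⟩
  rw [densityMeasure_Iic he0 hei hr, ← densityMeasure_distFun_le hd0 hdi
    ⟨distFun_nonneg he0 hei hr, hmass ▸ distFun_mono he0 hei hr ⟨zero_le_one, le_rfl⟩ hr.2⟩]
  refine measure_congr ?_
  filter_upwards [ae_densityMeasure_mem] with u hu
  exact propext (genInv_le_iff he0 hei
    (hmass ▸ distFun_mono hd0 hdi (Ioo_subset_Icc_self hu) ⟨zero_le_one, le_rfl⟩ hu.2.le) hr)

/-- The map sends u to the left end of its plateau, hence lies below the identity. It also preserves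
the measure, so both have the same integral and must agree almost everywhere. -/
lemma genInv_distFun_self_ae (hd : Measurable d) :
    ∀ᵐ u ∂densityMeasure d, genInv (distFun d) (distFun d u) = u := by
  have := isFiniteMeasure_densityMeasure hd0 hdi
  set g := fun u => genInv (distFun d) (distFun d u) with hg
  have hm : Measurable g := (measurable_genInv hd0 hdi).comp (measurable_distFun hd)
  have hmap := map_genInv_distFun hd0 hdi hd hd0 hdi rfl
  have hle : ∀ᵐ u ∂densityMeasure d, g u ≤ u := by
    filter_upwards [ae_densityMeasure_mem] with u hu
    have hu' : u ∈ Icc (0 : ℝ) 1 := Ioo_subset_Icc_self hu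
    exact (genInv_le_iff hd0 hdi (distFun_mono hd0 hdi hu' ⟨zero_le_one, le_rfl⟩ hu'.2) hu').2 le_rfl
  have hi1 : Integrable (fun u : ℝ => u) (densityMeasure d) := by
    refine Integrable.of_bound aestronglyMeasurable_id 1 ?_
    filter_upwards [ae_densityMeasure_mem] with u hu
    rw [Real.norm_eq_abs, abs_of_pos hu.1]; exact hu.2.le
  have hi2 : Integrable g (densityMeasure d) :=
    Integrable.of_bound hm.aestronglyMeasurable 1 (.of_forall fun u => by
      rw [Real.norm_eq_abs, abs_of_nonneg (genInv_mem _ _).1]; exact (genInv_mem _ _).2)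
  have hint : ∫ u, g u ∂densityMeasure d = ∫ u, u ∂densityMeasure d := by
    conv_rhs => rw [← hmap]
    rw [integral_id_map hm.aemeasurable]
  exact (integral_eq_iff_of_ae_le hi2 hi1 hle).1 hint

/-- The transport maps between two densities of equal mass are almost everywhere inverse. -/
lemma transport_inverse_ae (hd : Measurable d) (he0 : ∀ u, 0 ≤ e u)
    (hei : IntervalIntegrable e volume 0 1) (hmass : distFun d 1 = distFun e 1) :
    ∀ᵐ u ∂densityMeasure d, genInv (distFun d)
      (distFun e (genInv (distFun e) (distFun d u))) = u := by
  filter_upwards [genInv_distFun_self_ae hd0 hdi hd, ae_densityMeasure_mem] with u hu hu'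
  have hu' : u ∈ Icc (0 : ℝ) 1 := Ioo_subset_Icc_self hu'
  rw [distFun_genInv he0 hei ⟨distFun_nonneg hd0 hdi hu',
    hmass ▸ distFun_mono hd0 hdi hu' ⟨zero_le_one, le_rfl⟩ hu'.2⟩, hu]

end Transport

/-! ### Barycentres along quantiles -/

/-- Standing assumptions: finite first moments, equal means and barycentre dispersion. -/
structure IsDispersed (μ : Measure ℝ) (κ : Kernel ℝ ℝ) : Prop where
  isP1 : IsP1 μ
  integrable_snd : Integrable (fun z : ℝ × ℝ => z.2) (μ ⊗ₘ κ)
  mean_eq : ∫ x, x ∂μ = ∫ z, z.2 ∂(μ ⊗ₘ κ)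
  dispersion : BarycentreDispersion μ κ

section Barycentre

variable {μ : Measure ℝ} {κ : Kernel ℝ ℝ}

lemma measurable_barycentre (κ : Kernel ℝ ℝ) : Measurable fun x => ∫ y, y ∂(κ x) :=
  (StronglyMeasurable.integral_kernel (κ := κ) stronglyMeasurable_id).measurable

lemma measurable_G [IsProbabilityMeasure μ] : Measurable (G μ κ) :=
  (measurable_barycentre κ).comp (measurable_quantile μ)

/-- The positive part of the defect `F_μ⁻¹ - G`. -/
noncomputable def defectPos (μ : Measure ℝ) (κ : Kernel ℝ ℝ) (u : ℝ) : ℝ :=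
  max (quantile μ u - G μ κ u) 0

/-- The negative part of the defect `F_μ⁻¹ - G`. -/
noncomputable def defectNeg (μ : Measure ℝ) (κ : Kernel ℝ ℝ) (u : ℝ) : ℝ :=
  max (-(quantile μ u - G μ κ u)) 0

lemma DeltaPos_eq : DeltaPos μ κ = distFun (defectPos μ κ) := rfl

lemma DeltaNeg_eq : DeltaNeg μ κ = distFun (defectNeg μ κ) := rfl

lemma defectPos_nonneg (u : ℝ) : 0 ≤ defectPos μ κ u := le_max_right _ _

lemma defectNeg_nonneg (u : ℝ) : 0 ≤ defectNeg μ κ u := le_max_right _ _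

lemma measurable_defectPos [IsProbabilityMeasure μ] : Measurable (defectPos μ κ) :=
  ((measurable_quantile μ).sub measurable_G).max measurable_const

lemma measurable_defectNeg [IsProbabilityMeasure μ] : Measurable (defectNeg μ κ) :=
  ((measurable_quantile μ).sub measurable_G).neg.max measurable_const

lemma setIntegral_defect_Ici (h : IsDispersed μ κ) (a : ℝ) :
    ∫ u in quantile μ ⁻¹' Ici a, (quantile μ u - G μ κ u) ∂lam ≤ 0 := by
  have := h.isP1.1
  have hd := h.dispersion a
  conv at hd => rw [← map_quantile μ]
  rwa [setIntegral_map (f := fun x => x - ∫ y, y ∂(κ x)) measurableSet_Ici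
    (measurable_id.sub (measurable_barycentre κ)).aestronglyMeasurable
    (measurable_quantile μ).aemeasurable] at hd

variable [IsMarkovKernel κ] (h : IsDispersed μ κ)
include h

lemma integrable_kernel_ae : ∀ᵐ x ∂μ, Integrable (fun y : ℝ => y) (κ x) := by
  have := h.isP1.1
  exact ((Measure.integrable_compProd_iff h.integrable_snd.1).1 h.integrable_snd).1

lemma integrable_kernel_quantile_ae :
    ∀ᵐ u ∂lam, Integrable (fun y : ℝ => y) (κ (quantile μ u)) := by
  have := h.isP1.1
  have hae := integrable_kernel_ae h
  rw [← map_quantile μ] at hae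
  exact ae_of_ae_map (measurable_quantile μ).aemeasurable hae

lemma integrable_barycentre : Integrable (fun x => ∫ y, y ∂(κ x)) μ := by
  have := h.isP1.1
  refine ((Measure.integrable_compProd_iff h.integrable_snd.1).1 h.integrable_snd).2.mono'
    (measurable_barycentre κ).aestronglyMeasurable (.of_forall fun x => ?_)
  exact norm_integral_le_integral_norm _

lemma integrable_G : Integrable (G μ κ) lam := by
  have := h.isP1.1
  have hi := integrable_barycentre h
  rw [← map_quantile μ] at hi
  exact (integrable_map_measure (measurable_barycentre κ).aestronglyMeasurable
    (measurable_quantile μ).aemeasurable).1 hi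

lemma integrable_defect : Integrable (fun u => quantile μ u - G μ κ u) lam :=
  (integrable_quantile h.isP1).sub (integrable_G h)

lemma integral_defect : ∫ u, (quantile μ u - G μ κ u) ∂lam = 0 := by
  have := h.isP1.1
  have e : ∫ u, G μ κ u ∂lam = ∫ x, ∫ y, y ∂(κ x) ∂μ := by
    conv_rhs => rw [← map_quantile μ]
    rw [integral_map (measurable_quantile μ).aemeasurable
      (measurable_barycentre κ).aestronglyMeasurable]
    rfl
  rw [integral_sub (integrable_quantile h.isP1) (integrable_G h), integral_quantile, h.mean_eq,
    Measure.integral_compProd h.integrable_snd, e, sub_self]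

lemma setIntegral_defect_Ioi (a : ℝ) :
    ∫ u in quantile μ ⁻¹' Ioi a, (quantile μ u - G μ κ u) ∂lam ≤ 0 := by
  have := h.isP1.1
  have hU : quantile μ ⁻¹' Ioi a = ⋃ n : ℕ, quantile μ ⁻¹' Ici (a + 1 / ((n : ℝ) + 1)) := by
    ext u
    simp only [mem_preimage, mem_Ioi, mem_iUnion, mem_Ici]
    constructor
    · intro hlt
      obtain ⟨n, hn⟩ := exists_nat_one_div_lt (sub_pos.2 hlt)
      exact ⟨n, by linarith⟩
    · rintro ⟨n, hn⟩
      have : 0 < 1 / ((n : ℝ) + 1) := by positivity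
      linarith
  have hmono : Monotone fun n : ℕ => quantile μ ⁻¹' Ici (a + 1 / ((n : ℝ) + 1)) := by
    intro m n hmn
    exact preimage_mono (Ici_subset_Ici.2 (by gcongr))
  have hlim := tendsto_setIntegral_of_monotone (μ := lam)
    (f := fun u => quantile μ u - G μ κ u)
    (fun n : ℕ => measurable_quantile μ (measurableSet_Ici (a := a + 1 / ((n : ℝ) + 1)))) hmono
    (integrable_defect h).integrableOn
  rw [hU]
  exact le_of_tendsto hlim (.of_forall fun n => setIntegral_defect_Ici h _)

/-- Dispersion speaks of half-lines in x, whereas here a plateau of F⁻¹ may be cut at u. On the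
plateau G depends only on the value of F⁻¹, so the defect is a constant c, whose sign decides which
half-line to compare with. -/
lemma setIntegral_defect_level {u : ℝ} (hu : u ∈ Ioo (0 : ℝ) 1) :
    ∫ v in Ioi u, (quantile μ v - G μ κ v) ∂lam ≤ 0 := by
  have := h.isP1.1
  set a := quantile μ u with ha
  set c := a - ∫ y, y ∂(κ a) with hc
  have hi := integrable_defect h
  have hconst : ∀ v ∈ quantile μ ⁻¹' {a}, quantile μ v - G μ κ v = c := fun v hv => by
    have : quantile μ v = a := hv
    rw [G, this]
  have hma : MeasurableSet (quantile μ ⁻¹' {a}) := measurable_quantile μ (measurableSet_singleton a)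
  have hset : ∀ s, MeasurableSet s →
      ∫ v in quantile μ ⁻¹' {a} ∩ s, (quantile μ v - G μ κ v) ∂lam =
        lam.real (quantile μ ⁻¹' {a} ∩ s) * c := fun s hs => by
    rw [setIntegral_congr_fun (hma.inter hs) fun v hv => hconst v hv.1, setIntegral_const,
      smul_eq_mul]
  -- For c ≤ 0 the cut part of the plateau is added to the open half-line; for c ≥ 0 the missing
  -- part is removed from the closed one. Both operations preserve the sign.
  rcases le_total c 0 with hc0 | hc0
  · have e : (Ioi u : Set ℝ) =ᵐ[lam]
        (quantile μ ⁻¹' Ioi a ∪ (quantile μ ⁻¹' {a} ∩ Ioi u) : Set ℝ) := by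
      filter_upwards [ae_lam_mem] with v hv
      refine propext ?_
      change u < v ↔ (a < quantile μ v ∨ (quantile μ v = a ∧ u < v))
      constructor
      · intro huv
        rcases (quantile_mono μ hu hv huv.le).lt_or_eq with h1 | h1
        · exact Or.inl h1
        · exact Or.inr ⟨h1.symm, huv⟩
      · rintro (h1 | h1)
        · by_contra! hvu
          exact absurd (quantile_mono μ hv hu hvu) (not_le.2 h1)
        · exact h1.2
    have hdisj : Disjoint (quantile μ ⁻¹' Ioi a) (quantile μ ⁻¹' {a} ∩ Ioi u) :=
      disjoint_left.2 fun v hv hv' => (ne_of_gt (show a < quantile μ v from hv)) hv'.1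
    rw [setIntegral_congr_set e, setIntegral_union hdisj (hma.inter measurableSet_Ioi)
      hi.integrableOn hi.integrableOn, hset _ measurableSet_Ioi]
    have h1 := setIntegral_defect_Ioi h a
    have h2 := mul_nonpos_of_nonneg_of_nonpos
      (measureReal_nonneg (μ := lam) (s := quantile μ ⁻¹' {a} ∩ Ioi u)) hc0
    linarith
  · have e : (quantile μ ⁻¹' Ici a : Set ℝ) =ᵐ[lam]
        (Ioi u ∪ (quantile μ ⁻¹' {a} ∩ Iic u) : Set ℝ) := by
      filter_upwards [ae_lam_mem] with v hv
      refine propext ?_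
      change a ≤ quantile μ v ↔ (u < v ∨ (quantile μ v = a ∧ v ≤ u))
      constructor
      · intro h1
        rcases lt_or_ge u v with huv | huv
        · exact Or.inl huv
        · exact Or.inr ⟨le_antisymm (quantile_mono μ hv hu huv) h1, huv⟩
      · rintro (h1 | h1)
        · exact quantile_mono μ hu hv h1.le
        · exact h1.1.ge
    have h1 := setIntegral_defect_Ici h a
    have hdisj : Disjoint (Ioi u) (quantile μ ⁻¹' {a} ∩ Iic u) :=
      disjoint_left.2 fun v hv hv' => (not_le.2 (show u < v from hv)) hv'.2
    rw [setIntegral_congr_set e, setIntegral_union hdisj (hma.inter measurableSet_Iic)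
      hi.integrableOn hi.integrableOn, hset _ measurableSet_Iic] at h1
    have h2 := mul_nonneg
      (measureReal_nonneg (μ := lam) (s := quantile μ ⁻¹' {a} ∩ Iic u)) hc0
    linarith

lemma intervalIntegrable_defectPos : IntervalIntegrable (defectPos μ κ) volume 0 1 :=
  (intervalIntegrable_iff_integrableOn_Ioo_of_le zero_le_one).2 (integrable_defect h).pos_part

lemma intervalIntegrable_defectNeg : IntervalIntegrable (defectNeg μ κ) volume 0 1 :=
  (intervalIntegrable_iff_integrableOn_Ioo_of_le zero_le_one).2 (integrable_defect h).neg_part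

lemma DeltaPos_sub_DeltaNeg {u : ℝ} (hu : u ∈ Icc (0 : ℝ) 1) :
    DeltaPos μ κ u - DeltaNeg μ κ u = -∫ v in Ioi u, (quantile μ v - G μ κ v) ∂lam := by
  have hi := integrable_defect h
  have e1 : DeltaPos μ κ u - DeltaNeg μ κ u =
      ∫ v in (0 : ℝ)..u, (quantile μ v - G μ κ v) := by
    rw [DeltaPos_eq, DeltaNeg_eq, distFun, distFun, ← intervalIntegral.integral_sub
      (intervalIntegrable_sub (intervalIntegrable_defectPos h) le_rfl hu.1 hu.2)
      (intervalIntegrable_sub (intervalIntegrable_defectNeg h) le_rfl hu.1 hu.2)]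
    congr 1
    funext v
    exact max_zero_sub_max_neg_zero_eq_self _
  have e2 : ∫ v in (0 : ℝ)..u, (quantile μ v - G μ κ v) =
      ∫ v in Iic u, (quantile μ v - G μ κ v) ∂lam := by
    rw [intervalIntegral.integral_of_le hu.1, lam, Measure.restrict_restrict measurableSet_Iic]
    refine setIntegral_congr_set ?_
    have : ∀ᵐ x : ℝ, x ≠ 1 := by simp [ae_iff]
    filter_upwards [this] with x hx
    refine propext ?_
    change x ∈ Ioc 0 u ↔ x ∈ Iic u ∩ Ioo 0 1
    have := hu.2
    simp only [mem_inter_iff, mem_Iic, mem_Ioo, mem_Ioc]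
    grind
  have e3 := integral_add_compl (μ := lam) (measurableSet_Iic (a := u)) hi
  rw [integral_defect h, compl_Iic] at e3
  rw [e1, e2]
  linarith

/-- The form in which barycentre dispersion enters the pairing: the total defect is zero, so a
nonpositive integral to the right of u means a nonnegative one to its left. -/
lemma DeltaNeg_le_DeltaPos {u : ℝ} (hu : u ∈ Ioo (0 : ℝ) 1) : DeltaNeg μ κ u ≤ DeltaPos μ κ u := by
  have := DeltaPos_sub_DeltaNeg h (Ioo_subset_Icc_self hu)
  have := setIntegral_defect_level h hu
  linarith

lemma DeltaPos_one : DeltaPos μ κ 1 = DeltaNeg μ κ 1 := by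
  have e := DeltaPos_sub_DeltaNeg h (u := 1) ⟨zero_le_one, le_rfl⟩
  have : lam (Ioi 1) = 0 := by
    refine measure_eq_zero_iff_ae_notMem.2 ?_
    filter_upwards [ae_lam_mem] with u hu h
    exact lt_asymm hu.2 h
  rw [Measure.restrict_eq_zero.2 this, integral_zero_measure] at e
  linarith

end Barycentre

/-! ### The pairing of levels -/

section Pairing

variable {μ : Measure ℝ} {κ : Kernel ℝ ℝ}

lemma not_mem_UNeg {u : ℝ} (hu : u ∈ UPos μ κ) : u ∉ UNeg μ κ := fun h => lt_asymm hu.2.2 h.2.2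

lemma phi_of_mem_UPos {u : ℝ} (hu : u ∈ UPos μ κ) :
    phi μ κ u = genInv (DeltaNeg μ κ) (DeltaPos μ κ u) := by
  rw [phi, if_pos hu]

lemma phi_of_mem_UNeg {u : ℝ} (hu : u ∈ UNeg μ κ) :
    phi μ κ u = genInv (DeltaPos μ κ) (DeltaNeg μ κ u) := by
  rw [phi, if_neg fun h => not_mem_UNeg h hu, if_pos hu]

/-- Replacing u by φ(u) negates the denominator and puts the other defect in the numerator. The last
condition defining A⁺ and A⁻ is therefore automatic. -/
lemma pw_phi {u : ℝ} (hu : u ∈ UPos μ κ ∧ phi μ κ u ∈ UNeg μ κ ∨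
    u ∈ UNeg μ κ ∧ phi μ κ u ∈ UPos μ κ) (hinv : phi μ κ (phi μ κ u) = u) :
    pw μ κ (phi μ κ u) = 1 - pw μ κ u := by
  have hne : quantile μ u - G μ κ u + G μ κ (phi μ κ u) - quantile μ (phi μ κ u) ≠ 0 := by
    rcases hu with ⟨h1, h2⟩ | ⟨h1, h2⟩
    · have := h1.2.2
      have := h2.2.2
      exact ne_of_gt (by linarith)
    · have := h1.2.2
      have := h2.2.2
      exact ne_of_lt (by linarith)
  have hne' : quantile μ (phi μ κ u) - G μ κ (phi μ κ u) + G μ κ u - quantile μ u ≠ 0 := by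
    intro h0
    exact hne (by linarith)
  rw [pw, pw, hinv, eq_sub_iff_add_eq, div_add_div _ _ hne' hne, div_eq_one_iff_eq
    (mul_ne_zero hne' hne)]
  ring

lemma mem_APos_of {u : ℝ} (h1 : u ∈ UPos μ κ) (h2 : phi μ κ u ∈ UNeg μ κ)
    (h3 : phi μ κ (phi μ κ u) = u) : u ∈ APos μ κ := ⟨h1, h2, h3, pw_phi (.inl ⟨h1, h2⟩) h3⟩

lemma mem_ANeg_of {u : ℝ} (h1 : u ∈ UNeg μ κ) (h2 : phi μ κ u ∈ UPos μ κ)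
    (h3 : phi μ κ (phi μ κ u) = u) : u ∈ ANeg μ κ := ⟨h1, h2, h3, pw_phi (.inr ⟨h1, h2⟩) h3⟩

lemma phi_mem_ANeg {u : ℝ} (hu : u ∈ APos μ κ) : phi μ κ u ∈ ANeg μ κ :=
  mem_ANeg_of hu.2.1 (by rw [hu.2.2.1]; exact hu.1) (by rw [hu.2.2.1])

lemma phi_mem_APos {u : ℝ} (hu : u ∈ ANeg μ κ) : phi μ κ u ∈ APos μ κ :=
  mem_APos_of hu.2.1 (by rw [hu.2.2.1]; exact hu.1) (by rw [hu.2.2.1])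

lemma not_mem_APos {u : ℝ} (hu : u ∈ ANeg μ κ) : u ∉ APos μ κ := fun h => not_mem_UNeg h.1 hu.1

lemma weight_quad (u : ℝ) : weight (quad μ κ u) = pw μ κ u := rfl

lemma measurableSet_integrable_quantile [IsProbabilityMeasure μ] :
    MeasurableSet {u | Integrable (fun y : ℝ => y) (κ (quantile μ u))} :=
  (measurable_quantile μ) (ProbabilityTheory.measurableSet_integrable stronglyMeasurable_id)

lemma measurableSet_UPos [IsProbabilityMeasure μ] : MeasurableSet (UPos μ κ) :=
  measurableSet_Ioo.inter (measurableSet_integrable_quantile.inter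
    (measurableSet_lt measurable_G (measurable_quantile μ)))

lemma measurableSet_UNeg [IsProbabilityMeasure μ] : MeasurableSet (UNeg μ κ) :=
  measurableSet_Ioo.inter (measurableSet_integrable_quantile.inter
    (measurableSet_lt (measurable_quantile μ) measurable_G))

variable [IsMarkovKernel κ] (h : IsDispersed μ κ)
include h

/-- u = φ(φ(u)) is the least level at which Δ₊ reaches Δ₋(φ(u)), and Δ₋ ≤ Δ₊ makes φ(u) itself such
a level. -/
lemma le_phi {u : ℝ} (hu : u ∈ APos μ κ) : u ≤ phi μ κ u := by
  by_contra! hlt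
  have h2 := hu.2.1
  have hle := DeltaNeg_le_DeltaPos h h2.1
  have hinv := hu.2.2.1
  rw [phi_of_mem_UNeg h2] at hinv
  have hbdd : BddBelow {r | r ∈ Icc (0 : ℝ) 1 ∧ DeltaNeg μ κ (phi μ κ u) ≤ DeltaPos μ κ r} :=
    ⟨0, fun q hq => hq.1.1⟩
  have : genInv (DeltaPos μ κ) (DeltaNeg μ κ (phi μ κ u)) ≤ phi μ κ u :=
    csInf_le hbdd ⟨Ioo_subset_Icc_self h2.1, hle⟩
  linarith

lemma quad_mem {u : ℝ} (hu : u ∈ APos μ κ) : quad μ κ u ∈ quadruples := by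
  have := h.isP1.1
  exact ⟨⟨inferInstanceAs (IsProbabilityMeasure (κ _)), hu.1.2.1⟩,
    ⟨inferInstanceAs (IsProbabilityMeasure (κ _)), hu.2.1.2.1⟩, hu.1.2.2,
    quantile_mono μ hu.1.1 hu.2.1.1 (le_phi h hu), hu.2.1.2.2⟩

lemma measurable_DeltaPos_transport : Measurable fun u => genInv (DeltaNeg μ κ) (DeltaPos μ κ u) := by
  have := h.isP1.1
  exact (measurable_genInv defectNeg_nonneg (intervalIntegrable_defectNeg h)).comp
    (measurable_distFun measurable_defectPos)

lemma measurable_DeltaNeg_transport : Measurable fun u => genInv (DeltaPos μ κ) (DeltaNeg μ κ u) := by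
  have := h.isP1.1
  exact (measurable_genInv defectPos_nonneg (intervalIntegrable_defectPos h)).comp
    (measurable_distFun measurable_defectNeg)

lemma measurable_phi : Measurable (phi μ κ) := by
  have := h.isP1.1
  classical
  unfold phi
  exact Measurable.ite measurableSet_UPos (measurable_DeltaPos_transport h)
    (Measurable.ite measurableSet_UNeg (measurable_DeltaNeg_transport h) measurable_id)

lemma measurable_pw : Measurable (pw μ κ) := by
  have := h.isP1.1
  have h1 : Measurable (G μ κ) := measurable_G
  have h2 := measurable_quantile μ
  have h3 := measurable_phi h
  unfold pw
  fun_prop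

lemma measurableSet_APos : MeasurableSet (APos μ κ) := by
  have := h.isP1.1
  have h3 := measurable_phi h
  have h4 := measurable_pw h
  exact measurableSet_UPos.inter ((h3 measurableSet_UNeg).inter
    ((measurableSet_eq_fun (h3.comp h3) measurable_id).inter
      (measurableSet_eq_fun (h4.comp h3) (measurable_const.sub h4))))

lemma measurableSet_ANeg : MeasurableSet (ANeg μ κ) := by
  have := h.isP1.1
  have h3 := measurable_phi h
  have h4 := measurable_pw h
  exact measurableSet_UNeg.inter ((h3 measurableSet_UPos).inter
    ((measurableSet_eq_fun (h3.comp h3) measurable_id).inter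
      (measurableSet_eq_fun (h4.comp h3) (measurable_const.sub h4))))

lemma mem_UPos_iff_ae : ∀ᵐ u ∂lam, u ∈ UPos μ κ ↔ 0 < defectPos μ κ u := by
  filter_upwards [ae_lam_mem, integrable_kernel_quantile_ae h] with u hu hi
  rw [defectPos, lt_max_iff, sub_pos]
  exact ⟨fun h => .inl h.2.2, fun h => ⟨hu, hi, h.resolve_right (lt_irrefl _)⟩⟩

lemma mem_UNeg_iff_ae : ∀ᵐ u ∂lam, u ∈ UNeg μ κ ↔ 0 < defectNeg μ κ u := by
  filter_upwards [ae_lam_mem, integrable_kernel_quantile_ae h] with u hu hi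
  rw [defectNeg, lt_max_iff, neg_pos, sub_neg]
  exact ⟨fun h => .inl h.2.2, fun h => ⟨hu, hi, h.resolve_right (lt_irrefl _)⟩⟩

lemma map_defectPos : (densityMeasure (defectPos μ κ)).map
    (fun u => genInv (DeltaNeg μ κ) (DeltaPos μ κ u)) = densityMeasure (defectNeg μ κ) := by
  have := h.isP1.1
  exact map_genInv_distFun defectPos_nonneg (intervalIntegrable_defectPos h) measurable_defectPos
    defectNeg_nonneg (intervalIntegrable_defectNeg h) (DeltaPos_one h)

lemma map_defectNeg : (densityMeasure (defectNeg μ κ)).map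
    (fun u => genInv (DeltaPos μ κ) (DeltaNeg μ κ u)) = densityMeasure (defectPos μ κ) := by
  have := h.isP1.1
  exact map_genInv_distFun defectNeg_nonneg (intervalIntegrable_defectNeg h) measurable_defectNeg
    defectPos_nonneg (intervalIntegrable_defectPos h) (DeltaPos_one h).symm

/-- The transport carries the density of the positive defect to that of the negative defect, which
charges only 𝒰⁻, and the reverse transport undoes it. Null sets for the density are Lebesgue-null
within 𝒰⁺. -/
lemma UPos_subset_APos_ae : ∀ᵐ u ∂lam, u ∈ UPos μ κ → u ∈ APos μ κ := by
  have := h.isP1.1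
  have hU : ∀ᵐ v ∂densityMeasure (defectNeg μ κ), v ∈ UNeg μ κ := by
    rw [ae_densityMeasure_iff measurable_defectNeg]
    filter_upwards [mem_UNeg_iff_ae h] with u hu using hu.2
  rw [← map_defectPos h] at hU
  have h1 := (ae_densityMeasure_iff measurable_defectPos).1
    (ae_of_ae_map (measurable_DeltaPos_transport h).aemeasurable hU)
  have h2 := (ae_densityMeasure_iff measurable_defectPos).1
    (transport_inverse_ae defectPos_nonneg (intervalIntegrable_defectPos h) measurable_defectPos
      defectNeg_nonneg (intervalIntegrable_defectNeg h) (DeltaPos_one h))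
  filter_upwards [mem_UPos_iff_ae h, h1, h2] with u hu h1 h2 hm
  have hpos := hu.1 hm
  have hphi := phi_of_mem_UPos hm
  refine mem_APos_of hm (hphi ▸ h1 hpos) ?_
  rw [phi_of_mem_UNeg (hphi ▸ h1 hpos), hphi]
  exact h2 hpos

lemma UNeg_subset_ANeg_ae : ∀ᵐ u ∂lam, u ∈ UNeg μ κ → u ∈ ANeg μ κ := by
  have := h.isP1.1
  have hU : ∀ᵐ v ∂densityMeasure (defectPos μ κ), v ∈ UPos μ κ := by
    rw [ae_densityMeasure_iff measurable_defectPos]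
    filter_upwards [mem_UPos_iff_ae h] with u hu using hu.2
  rw [← map_defectNeg h] at hU
  have h1 := (ae_densityMeasure_iff measurable_defectNeg).1
    (ae_of_ae_map (measurable_DeltaNeg_transport h).aemeasurable hU)
  have h2 := (ae_densityMeasure_iff measurable_defectNeg).1
    (transport_inverse_ae defectNeg_nonneg (intervalIntegrable_defectNeg h) measurable_defectNeg
      defectPos_nonneg (intervalIntegrable_defectPos h) (DeltaPos_one h).symm)
  filter_upwards [mem_UNeg_iff_ae h, h1, h2] with u hu h1 h2 hm
  have hpos := hu.1 hm
  have hphi := phi_of_mem_UNeg hm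
  refine mem_ANeg_of hm (hphi ▸ h1 hpos) ?_
  rw [phi_of_mem_UPos (hphi ▸ h1 hpos), hphi]
  exact h2 hpos

/-- Levels outside `A⁺ ∪ A⁻` have no defect, up to a null set. -/
lemma G_eq_quantile_ae : ∀ᵐ u ∂lam, u ∉ APos μ κ → u ∉ ANeg μ κ → G μ κ u = quantile μ u := by
  filter_upwards [UPos_subset_APos_ae h, UNeg_subset_ANeg_ae h, ae_lam_mem,
    integrable_kernel_quantile_ae h] with u h1 h2 hu hi n1 n2
  rcases lt_trichotomy (G μ κ u) (quantile μ u) with hlt | heq | hgt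
  · exact absurd (h1 ⟨hu, hi, hlt⟩) n1
  · exact heq
  · exact absurd (h2 ⟨hu, hi, hgt⟩) n2

/-- Change of variables along `φ`. -/
lemma setLIntegral_ANeg {f : ℝ → ENNReal} (hf : Measurable f) :
    ∫⁻ v in ANeg μ κ, f v ∂lam = ∫⁻ u in APos μ κ,
      ENNReal.ofReal ((quantile μ u - G μ κ u) /
        (G μ κ (phi μ κ u) - quantile μ (phi μ κ u))) * f (phi μ κ u) ∂lam := by
  have := h.isP1.1
  have hmA := measurableSet_ANeg h
  have hmP := measurableSet_APos h
  -- Dividing by the density turns the Lebesgue integral over A⁻ into an integral against the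
  -- negative defect, to which the transport applies.
  set k : ℝ → ENNReal := (ANeg μ κ).indicator
    fun v => (ENNReal.ofReal (defectNeg μ κ v))⁻¹ * f v with hk
  have hkm : Measurable k := (measurable_defectNeg.ennreal_ofReal.inv.mul hf).indicator hmA
  have hneg : ∀ v ∈ ANeg μ κ, defectNeg μ κ v = G μ κ v - quantile μ v ∧ 0 < defectNeg μ κ v := by
    intro v hv
    have hlt := hv.1.2.2
    have : defectNeg μ κ v = G μ κ v - quantile μ v := by
      rw [defectNeg, neg_sub, max_eq_left (by linarith)]
    exact ⟨this, by linarith⟩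
  have e1 : ∫⁻ v in ANeg μ κ, f v ∂lam = ∫⁻ v, k v ∂densityMeasure (defectNeg μ κ) := by
    rw [densityMeasure, lintegral_withDensity_eq_lintegral_mul _
      measurable_defectNeg.ennreal_ofReal hkm, ← lintegral_indicator hmA]
    refine lintegral_congr fun v => ?_
    by_cases hv : v ∈ ANeg μ κ
    · have h0 : ENNReal.ofReal (defectNeg μ κ v) ≠ 0 := by
        simpa using (hneg v hv).2
      rw [indicator_of_mem hv, Pi.mul_apply, hk, indicator_of_mem hv, ← mul_assoc,
        ENNReal.mul_inv_cancel h0 ENNReal.ofReal_ne_top, one_mul]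
    · rw [indicator_of_notMem hv, Pi.mul_apply, hk, indicator_of_notMem hv, mul_zero]
  have hgm := measurable_DeltaPos_transport h
  have hcm : Measurable fun u => k (genInv (DeltaNeg μ κ) (DeltaPos μ κ u)) := hkm.comp hgm
  rw [e1, ← map_defectPos h, lintegral_map hkm hgm, densityMeasure,
    lintegral_withDensity_eq_lintegral_mul _ measurable_defectPos.ennreal_ofReal hcm,
    ← lintegral_indicator hmP]
  refine lintegral_congr_ae ?_
  filter_upwards [mem_UPos_iff_ae h, UPos_subset_APos_ae h] with u h1 h2
  by_cases hu : u ∈ APos μ κ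
  · have hphi := phi_of_mem_UPos hu.1
    have hlt := hu.1.2.2
    have hd : defectPos μ κ u = quantile μ u - G μ κ u := by
      rw [defectPos, max_eq_left (by linarith)]
    obtain ⟨n1, n2⟩ := hneg _ (phi_mem_ANeg hu)
    rw [indicator_of_mem hu, Pi.mul_apply, ← hphi, hk, indicator_of_mem (phi_mem_ANeg hu), hd,
      ← mul_assoc, ← n1, ENNReal.ofReal_div_of_pos n2, div_eq_mul_inv]
  · have hz : ENNReal.ofReal (defectPos μ κ u) = 0 := by
      rw [ENNReal.ofReal_eq_zero]
      by_contra! hpos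
      exact hu (h2 (h1.2 hpos))
    rw [indicator_of_notMem hu, Pi.mul_apply, hz, zero_mul]

end Pairing

/-! ### The martingale kernel -/

/-- Exchange maps are measurable only on `quadruples`, so each branch of `mker` is measurable only
on its own piece. -/
lemma measurable_ite_of_restrict {X Y : Type*} [MeasurableSpace X] [MeasurableSpace Y] {A : Set X}
    [DecidablePred (· ∈ A)] (hA : MeasurableSet A) {f g : X → Y}
    (hf : Measurable fun x : A => f x) (hg : Measurable g) :
    Measurable fun x => if x ∈ A then f x else g x := by
  refine measurable_of_restrict_of_restrict_compl hA ?_ ?_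
  · convert hf using 1
    funext x
    exact if_pos x.2
  · convert hg.comp (measurable_subtype_coe (p := fun x => x ∈ Aᶜ)) using 1
    funext x
    exact if_neg x.2

section Mker

variable {μ : Measure ℝ} {κ : Kernel ℝ ℝ}
  {β β' : ℝ × ℝ × Measure ℝ × Measure ℝ → Measure ℝ}

lemma mker_of_mem_APos {u : ℝ} (hu : u ∈ APos μ κ) : mker β β' μ κ u = β (quad μ κ u) := by
  rw [mker, if_pos hu]

lemma mker_of_mem_ANeg {u : ℝ} (hu : u ∈ ANeg μ κ) :
    mker β β' μ κ u = β' (quad μ κ (phi μ κ u)) := by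
  rw [mker, if_neg (not_mem_APos hu), if_pos hu]

lemma mker_of_notMem {u : ℝ} (h1 : u ∉ APos μ κ) (h2 : u ∉ ANeg μ κ) :
    mker β β' μ κ u = κ (quantile μ u) := by
  rw [mker, if_neg h1, if_neg h2]

variable [IsMarkovKernel κ] (h : IsDispersed μ κ) (hβ : IsExchange β β')
include h

lemma measurable_quad : Measurable (quad μ κ) := by
  have := h.isP1.1
  have h2 := measurable_quantile μ
  have h3 := measurable_phi h
  have h4 := Kernel.measurable κ
  unfold quad
  fun_prop

include hβ

lemma measurable_mker : Measurable (mker β β' μ κ) := by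
  have := h.isP1.1
  have hq := measurable_quad h
  have h1 : Measurable fun u : APos μ κ => β (quad μ κ u) :=
    hβ.measurable_fst.comp ((hq.comp measurable_subtype_coe).subtype_mk
      (h := fun u => quad_mem h u.2))
  have h2 : Measurable fun u : ANeg μ κ => β' (quad μ κ (phi μ κ u)) :=
    hβ.measurable_snd.comp (((hq.comp (measurable_phi h)).comp measurable_subtype_coe).subtype_mk
      (h := fun u => quad_mem h (phi_mem_APos u.2)))
  classical
  unfold mker
  exact measurable_ite_of_restrict (measurableSet_APos h) h1
    (measurable_ite_of_restrict (measurableSet_ANeg h) h2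
      ((Kernel.measurable κ).comp (measurable_quantile μ)))

lemma isProbabilityMeasure_mker (u : ℝ) : IsProbabilityMeasure (mker β β' μ κ u) := by
  by_cases h1 : u ∈ APos μ κ
  · rw [mker_of_mem_APos h1]
    exact (hβ.isP1_fst _ (quad_mem h h1)).1
  by_cases h2 : u ∈ ANeg μ κ
  · rw [mker_of_mem_ANeg h2]
    exact (hβ.isP1_snd _ (quad_mem h (phi_mem_APos h2))).1
  · rw [mker_of_notMem h1 h2]
    infer_instance

lemma mker_martingale_ae : ∀ᵐ u ∂lam, Integrable (fun y : ℝ => y) (mker β β' μ κ u) ∧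
    ∫ y, y ∂(mker β β' μ κ u) = quantile μ u := by
  filter_upwards [G_eq_quantile_ae h, integrable_kernel_quantile_ae h] with u hG hi
  by_cases h1 : u ∈ APos μ κ
  · rw [mker_of_mem_APos h1]
    exact ⟨(hβ.isP1_fst _ (quad_mem h h1)).2, hβ.mean_fst _ (quad_mem h h1)⟩
  by_cases h2 : u ∈ ANeg μ κ
  · have hq := quad_mem h (phi_mem_APos h2)
    rw [mker_of_mem_ANeg h2]
    refine ⟨(hβ.isP1_snd _ hq).2, (hβ.mean_snd _ hq).trans ?_⟩
    change quantile μ (phi μ κ (phi μ κ u)) = quantile μ u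
    rw [h2.2.2.1]
  · rw [mker_of_notMem h1 h2]
    exact ⟨hi, hG h1 h2⟩

lemma W1_mker_ae : ∀ᵐ u ∂lam, W1 (κ (quantile μ u)) (mker β β' μ κ u) =
    ENNReal.ofReal |G μ κ u - quantile μ u| := by
  filter_upwards [G_eq_quantile_ae h] with u hG
  by_cases h1 : u ∈ APos μ κ
  · have hq := quad_mem h h1
    have hst : StochLE (κ (quantile μ u)) (β (quad μ κ u)) := hβ.stochLE_fst (quad μ κ u) hq
    have hmean : ∫ y, y ∂(β (quad μ κ u)) = quantile μ u := hβ.mean_fst (quad μ κ u) hq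
    rw [mker_of_mem_APos h1, W1_eq_of_stochLE ⟨inferInstance, h1.1.2.1⟩ (hβ.isP1_fst (quad μ κ u) hq)
      (.inl hst), hmean]
    rfl
  by_cases h2 : u ∈ ANeg μ κ
  · have hq := quad_mem h (phi_mem_APos h2)
    have hst : StochLE (β' (quad μ κ (phi μ κ u))) (κ (quantile μ (phi μ κ (phi μ κ u)))) :=
      hβ.stochLE_snd (quad μ κ (phi μ κ u)) hq
    have hmean : ∫ y, y ∂(β' (quad μ κ (phi μ κ u))) = quantile μ (phi μ κ (phi μ κ u)) :=
      hβ.mean_snd (quad μ κ (phi μ κ u)) hq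
    rw [h2.2.2.1] at hst hmean
    rw [mker_of_mem_ANeg h2, W1_eq_of_stochLE ⟨inferInstance, h2.1.2.1⟩ (hβ.isP1_snd (quad μ κ (phi μ κ u)) hq)
      (.inr hst), hmean]
    rfl
  · rw [mker_of_notMem h1 h2, W1_self, hG h1 h2, sub_self, abs_zero, ENNReal.ofReal_zero]

/-- Exchanging mass between paired levels preserves the mixture of the two laws. -/
lemma mker_add_phi {u : ℝ} (hu : u ∈ APos μ κ) (S : Set ℝ) :
    mker β β' μ κ u S + ENNReal.ofReal ((quantile μ u - G μ κ u) /
        (G μ κ (phi μ κ u) - quantile μ (phi μ κ u))) * mker β β' μ κ (phi μ κ u) S =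
      κ (quantile μ u) S + ENNReal.ofReal ((quantile μ u - G μ κ u) /
        (G μ κ (phi μ κ u) - quantile μ (phi μ κ u))) * κ (quantile μ (phi μ κ u)) S := by
  have hq := quad_mem h hu
  have hw := weight_mem hq
  have hpos : 0 < 1 - weight (quad μ κ u) := sub_pos.2 hw.2
  rw [mker_of_mem_APos hu, mker_of_mem_ANeg (phi_mem_ANeg hu), hu.2.2.1]
  have hmix := congrArg (fun ρ : Measure ℝ => ρ S) (hβ.mixture _ hq)
  simp only [Measure.add_apply, Measure.smul_apply, smul_eq_mul] at hmix
  -- The Jacobian of φ at u is the ratio of the two defects, and p is chosen so that this equals (1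
  -- - p)/p. Multiplying by p yields the mixture identity.
  have hr : (quantile μ u - G μ κ u) / (G μ κ (phi μ κ u) - quantile μ (phi μ κ u)) =
      (1 - weight (quad μ κ u)) / weight (quad μ κ u) := by
    have h1 := hu.1.2.2
    have h2 := hu.2.1.2.2
    have d1 : G μ κ (phi μ κ u) - quantile μ (phi μ κ u) ≠ 0 := ne_of_gt (by linarith)
    have d2 : quantile μ u - G μ κ u + G μ κ (phi μ κ u) - quantile μ (phi μ κ u) ≠ 0 :=
      ne_of_gt (by linarith)
    rw [weight_quad, pw]
    field_simp
    ring
  obtain ⟨hw0, -⟩ := ofReal_weight_ne hq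
  rw [hr, ENNReal.ofReal_div_of_pos hw.1]
  refine (ENNReal.mul_right_inj hw0 ENNReal.ofReal_ne_top).1 ?_
  have hc : ∀ x : ENNReal, ENNReal.ofReal (weight (quad μ κ u)) *
      (ENNReal.ofReal (1 - weight (quad μ κ u)) / ENNReal.ofReal (weight (quad μ κ u)) * x) =
      ENNReal.ofReal (1 - weight (quad μ κ u)) * x := fun x => by
    rw [← mul_assoc, ENNReal.mul_div_cancel hw0 ENNReal.ofReal_ne_top]
  rw [mul_add, mul_add, hc, hc]
  exact hmix

/-- Folding the integral over A⁻ onto A⁺ along φ reduces preservation of the second marginal to the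
identity for each pair (u, φ(u)); elsewhere the kernel is unchanged. -/
lemma lintegral_mker {S : Set ℝ} (hS : MeasurableSet S) :
    ∫⁻ u, mker β β' μ κ u S ∂lam = ∫⁻ u, κ (quantile μ u) S ∂lam := by
  have := h.isP1.1
  have hm1 : Measurable fun u => mker β β' μ κ u S :=
    (Measure.measurable_coe hS).comp (measurable_mker h hβ)
  have hm2 : Measurable fun u => κ (quantile μ u) S :=
    (Kernel.measurable_coe κ hS).comp (measurable_quantile μ)
  have hA := measurableSet_APos h
  have hA' := measurableSet_ANeg h
  have hsplit : ∀ f : ℝ → ENNReal, Measurable f → ∫⁻ u, f u ∂lam =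
      ∫⁻ u in APos μ κ, (f u + ENNReal.ofReal ((quantile μ u - G μ κ u) /
        (G μ κ (phi μ κ u) - quantile μ (phi μ κ u))) * f (phi μ κ u)) ∂lam +
      ∫⁻ u in (APos μ κ ∪ ANeg μ κ)ᶜ, f u ∂lam := by
    intro f hf
    rw [lintegral_add_left hf, ← setLIntegral_ANeg h hf,
      ← lintegral_union hA' (disjoint_left.2 fun u h1 h2 => not_mem_APos h2 h1),
      lintegral_add_compl _ (hA.union hA')]
  rw [hsplit _ hm1, hsplit _ hm2]
  congr 1
  · exact setLIntegral_congr_fun hA fun u hu => mker_add_phi h hβ hu S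
  · refine setLIntegral_congr_fun (hA.union hA').compl fun u hu => ?_
    simp only [mem_compl_iff, mem_union, not_or] at hu
    exact congrArg (fun ρ : Measure ℝ => ρ S) (mker_of_notMem hu.1 hu.2)

end Mker

/-! ### Lifted couplings from kernels -/

lemma bind_comp_quantile (μ : Measure ℝ) [IsProbabilityMeasure μ] (κ : Kernel ℝ ℝ)
    [IsMarkovKernel κ] {S : Set ℝ} (hS : MeasurableSet S) :
    ∫⁻ u, κ (quantile μ u) S ∂lam = (μ ⊗ₘ κ).map Prod.snd S := by
  rw [show (μ ⊗ₘ κ).map Prod.snd = μ.bind κ from Measure.snd_compProd μ κ,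
    Measure.bind_apply hS (Kernel.aemeasurable _)]
  conv_rhs => rw [← map_quantile μ]
  rw [lintegral_map (Kernel.measurable_coe κ hS) (measurable_quantile μ)]

lemma isLiftOf_iota (μ : Measure ℝ) [IsProbabilityMeasure μ] (κ : Kernel ℝ ℝ)
    [IsMarkovKernel κ] : IsLiftOf μ (μ ⊗ₘ κ) (iota μ κ) := by
  have e : iota μ κ = lift μ (κ.comap (quantile μ) (measurable_quantile μ)) := rfl
  refine ⟨⟨_, inferInstance, e⟩, ?_⟩
  rw [e, map_snd_lift]
  ext S hS
  rw [Measure.bind_apply hS (Kernel.aemeasurable _), Measure.compProd_apply hS]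
  conv_rhs => rw [← map_quantile μ]
  rw [lintegral_map (Kernel.measurable_kernel_prodMk_left hS) (measurable_quantile μ)]
  refine lintegral_congr fun u => ?_
  rw [liftKernel_apply, Measure.dirac_prod, Measure.map_apply measurable_prodMk_left hS,
    Kernel.comap_apply]

section Lifts

variable {μ ν : Measure ℝ} {κ : Kernel ℝ ℝ}
  {β β' : ℝ × ℝ × Measure ℝ × Measure ℝ → Measure ℝ}

lemma isDispersed_of_isCoupling (hμ : IsP1 μ) (hν : IsP1 ν) (hcx : ConvexOrder μ ν)
    (hπ : IsCoupling μ ν (μ ⊗ₘ κ)) (hbd : BarycentreDispersion μ κ) : IsDispersed μ κ := by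
  have hi : Integrable (fun z : ℝ × ℝ => z.2) (μ ⊗ₘ κ) := by
    have := hν.2
    rw [← hπ.2] at this
    exact (integrable_map_measure aestronglyMeasurable_id measurable_snd.aemeasurable).1 this
  have e : ∫ y, y ∂ν = ∫ z, z.2 ∂(μ ⊗ₘ κ) := by
    rw [← hπ.2, integral_id_map measurable_snd.aemeasurable]
  -- Testing the convex order with x and -x gives equality of the means, the only consequence of it
  -- that is needed.
  have h1 := hcx (fun x => x) (convexOn_id convex_univ) hμ.2 hν.2
  have h2 := hcx (fun x => -x) (concaveOn_id convex_univ).neg hμ.2.neg hν.2.neg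
  rw [integral_neg, integral_neg] at h2
  exact ⟨hμ, hi, by linarith, hbd⟩

variable [IsMarkovKernel κ] (h : IsDispersed μ κ)
include h

/-- The kernel `m`. -/
noncomputable def mkernel (hβ : IsExchange β β') : Kernel ℝ ℝ :=
  ⟨mker β β' μ κ, measurable_mker h hβ⟩

instance (hβ : IsExchange β β') : IsMarkovKernel (mkernel h hβ) :=
  ⟨isProbabilityMeasure_mker h hβ⟩

lemma Mhat_eq_lift (hβ : IsExchange β β') : Mhat β β' μ κ = lift μ (mkernel h hβ) := rfl

lemma isLiftedMartingaleCoupling_Mhat (hβ : IsExchange β β') (hπ : IsCoupling μ ν (μ ⊗ₘ κ)) :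
    IsLiftedMartingaleCoupling μ ν (Mhat β β' μ κ) := by
  have := h.isP1.1
  rw [Mhat_eq_lift h hβ]
  refine ⟨⟨(lift μ (mkernel h hβ)).map Prod.snd, ⟨map_fst_map_snd_lift, ?_⟩,
    ⟨_, inferInstance, rfl⟩, rfl⟩, _, inferInstance, rfl, mker_martingale_ae h hβ⟩
  rw [map_snd_map_snd_lift, ← hπ.2]
  ext S hS
  rw [Measure.bind_apply hS (Kernel.aemeasurable _), ← bind_comp_quantile μ κ hS]
  exact lintegral_mker h hβ hS

lemma liftedAW1_iota_Mhat_le (hβ : IsExchange β β') : liftedAW1 (iota μ κ) (Mhat β β' μ κ) ≤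
    ∫⁻ u in Ioo (0 : ℝ) 1, W1 (κ (quantile μ u)) (mker β β' μ κ u) := by
  have := h.isP1.1
  exact liftedAW1_lift_le (p := κ.comap (quantile μ) (measurable_quantile μ)) (p' := mkernel h hβ)

lemma le_liftedAW1_iota {M' : Measure (ℝ × ℝ × ℝ)} (hM : IsLiftedMartingaleCoupling μ ν M') :
    ∫⁻ u, ENNReal.ofReal |G μ κ u - quantile μ u| ∂lam ≤ liftedAW1 (iota μ κ) M' := by
  have := h.isP1.1
  obtain ⟨-, p', hp', rfl, hmart⟩ := hM
  refine le_liftedAW1_of_martingale (p := κ.comap (quantile μ) (measurable_quantile μ))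
    measurable_G ?_ hmart
  filter_upwards [integrable_kernel_quantile_ae h] with u hu
  exact ⟨hu, rfl⟩

end Lifts

end MartRearr
theorem mainTheorem2 (μ ν : Measure ℝ) (hμ : IsP1 μ) (hν : IsP1 ν) (hcx : ConvexOrder μ ν)
    (hne : μ ≠ ν) (π : Measure (ℝ × ℝ)) (hπ : IsCoupling μ ν π)
    (κ : Kernel ℝ ℝ) [IsMarkovKernel κ] (hκ : π = μ ⊗ₘ κ) (hbd : BarycentreDispersion μ κ) :
    IsExchange exchangeFst exchangeSnd ∧
    ∀ β β' : ℝ × ℝ × Measure ℝ × Measure ℝ → Measure ℝ, IsExchange β β' →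
      Measurable (mker β β' μ κ) ∧
      (∀ u, IsProbabilityMeasure (mker β β' μ κ u)) ∧
      IsLiftOf μ π (iota μ κ) ∧
      IsLiftedMartingaleRearrangement μ ν (iota μ κ) (Mhat β β' μ κ) ∧
      infLiftedAW1 μ ν (iota μ κ) = liftedAW1 (iota μ κ) (Mhat β β' μ κ) ∧
      liftedAW1 (iota μ κ) (Mhat β β' μ κ) =
        ∫⁻ u in Ioo (0 : ℝ) 1, W1 (κ (quantile μ u)) (mker β β' μ κ u) ∧
      IntegrableOn (fun u => |G μ κ u - quantile μ u|) (Ioo (0 : ℝ) 1) ∧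
      ∫⁻ u in Ioo (0 : ℝ) 1, W1 (κ (quantile μ u)) (mker β β' μ κ u) =
        ENNReal.ofReal (∫ u in Ioo (0 : ℝ) 1, |G μ κ u - quantile μ u|) := by
  refine ⟨isExchange_exchangeFst_exchangeSnd, fun β β' hβ => ?_⟩
  have := hμ.1
  have h : IsDispersed μ κ := isDispersed_of_isCoupling hμ hν hcx (hκ ▸ hπ) hbd
  have hW : ∫⁻ u in Ioo (0 : ℝ) 1, W1 (κ (quantile μ u)) (mker β β' μ κ u) =
      ∫⁻ u, ENNReal.ofReal |G μ κ u - quantile μ u| ∂lam := lintegral_congr_ae (W1_mker_ae h hβ)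
  have hM := isLiftedMartingaleCoupling_Mhat h hβ (hκ ▸ hπ)
  have hlow := fun M' => le_liftedAW1_iota (M' := M') (ν := ν) h
  have hup := liftedAW1_iota_Mhat_le h hβ
  have heq : liftedAW1 (iota μ κ) (Mhat β β' μ κ) =
      ∫⁻ u, ENNReal.ofReal |G μ κ u - quantile μ u| ∂lam :=
    le_antisymm (hup.trans hW.le) (hlow _ hM)
  have hinf : infLiftedAW1 μ ν (iota μ κ) = liftedAW1 (iota μ κ) (Mhat β β' μ κ) :=
    le_antisymm (iInf₂_le _ hM) (le_iInf₂ fun M' hM' => heq.le.trans (hlow M' hM'))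
  have hint : Integrable (fun u => |G μ κ u - quantile μ u|) lam :=
    ((integrable_G h).sub (integrable_quantile hμ)).abs
  refine ⟨measurable_mker h hβ, isProbabilityMeasure_mker h hβ, hκ ▸ isLiftOf_iota μ κ,
    ⟨hM, hinf.symm⟩, hinf, heq.trans hW.symm, hint, hW.trans ?_⟩
  exact (ofReal_integral_eq_lintegral_ofReal hint (.of_forall fun _ => abs_nonneg _)).symm
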